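/- Let $K$ be a $p$-adic field (a finite extension of $\mathbb{Q}_p$) with ring of integers $\mathcal{O}$, uniformizer $\pi$, residue field of cardinality $q$, valuation $v=\mathrm{ord}_\pi$ and absolute value $|x|=q^{-v(x)}$, $|0|=0$. Let $|dx|$ be the Haar measure on $K^N$ with $|dx|(\mathcal{O}^N)=1$. For a nonzero polynomial $f=\sum_\omega a_\omega x^\omega\in\mathcal{O}[x_1,\dots,x_n]$ with $f(0)=0$, let $\Gamma_f$ be its Newton polyhedron, i.e. the convex hull of $\bigcup_{a_\omega\neq 0}(\omega+\mathbb{R}_{\ge 0}^n)$. A face of $\Gamma_f$ is $\Gamma_f$ itself or its intersection with a supporting hyperplane; for a face $\tau$ put $f_\tau=\sum_{\omega\in\tau}a_\omega x^\omega$. For $a\in\mathbb{R}_{\ge 0}^n$ put $m_f(a)=\inf_{x\in\Gamma_f}a\cdot x$, $F_f(a)=\{x\in\Gamma_f: a\cdot x=m_f(a)\}$, and let $\Delta_{f,\tau}=\{a\in\mathbb{R}_{\ge 0}^n: F_f(a)=\tau\}$, with closure $\overline{\Delta}_{f,\tau}$. The polynomial $f$ is *Newton non-critical* if for every face $\tau$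 of $\Gamma_f$ the system $\partial f_\tau/\partial x_1=\dots=\partial f_\tau/\partial x_n=0$ has no solution in $(K^\times)^n$. For $h\in\mathcal{O}[z_1,\dots,z_N]$ and $A\subseteq\mathbb{R}^N$ put $$Z_A(h;s)=\int_{\{z\in\mathcal{O}^N:\ (v(z_1),\dots,v(z_N))\in A\}}|h(z)|^s\,|dz|,\qquad \mathrm{Re}(s)>0.$$ For polynomials $f$ in $n$ variables and $g$ in $m$ other variables put $(f\oplus g)(x,y)=f(x)+g(y)$. For $a\in\mathbb{N}^n$ and $b\in\mathbb{N}^m$, writing $|a|$, $|b|$ for the sums of the coordinates, set $$c_{a,b}(s)=-\,\mathrm{lcm}(m_f(a),m_g(b))\,s-\frac{m_f(a)}{\gcd(m_f(a),m_g(b))}|b|-\frac{m_g(b)}{\gcd(m_f(a),m_g(b))}|a|$$ if $m_f(a)>0$ and $m_g(b)>0$, and $c_{a,b}(s)=-\infty$ (so $q^{c_{a,b}(s)}=0$) if $m_f(a)=0$ or $m_g(b)=0$. **Proposition.** Let $f\in\mathcal{O}[x_1,\dots,x_n]$ and $g\in\mathcal{O}[y_1,\dots,y_m]$ be nonzero Newton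 non-critical polynomials with $f(0)=0$ and $g(0)=0$, and let $\tau$ and $\gamma$ be any faces of $\Gamma_f$ and $\Gamma_g$. Let $a_1,\dots,a_u\in\mathbb{N}^n$ and $b_1,\dots,b_v\in\mathbb{N}^m$ ($u,v\ge 0$) be families that are linearly independent over $\mathbb{R}$ and satisfy $$\Delta_1:=\bigoplus_{i=1}^u\mathbb{N}a_i\subseteq\overline{\Delta}_{f,\tau},\qquad \Delta_2:=\bigoplus_{j=1}^v\mathbb{N}b_j\subseteq\overline{\Delta}_{g,\gamma}.$$ Then there is a polynomial $P\in\mathbb{Q}[T]$ such that, for all $s\in\mathbb{C}$ with $\mathrm{Re}(s)>0$, the integral $Z_{\Delta_1\times\Delta_2}(f_\tau\oplus g_\gamma;s)$ converges absolutely and $$Z_{\Delta_1\times\Delta_2}(f_\tau\oplus g_\gamma;s)=\frac{P(q^{-s})}{(1-q^{-1-s})\prod_{i=1}^u\prod_{j=1}^v\bigl(1-q^{c_{a_i,b_j}(s)}\bigr)}.$$ -/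

import Mathlib

open MeasureTheory
open scoped ValuativeRel Polynomial

noncomputable section

namespace NewtonIgusa

section Newton

variable {σ : Type*} [Fintype σ] {R : Type*} [CommRing R]

/-- An exponent vector, seen as a point of `ℝ^σ`. -/
def toReal (a : σ → ℕ) : σ → ℝ := fun i => (a i : ℝ)

/-- The Newton polyhedron `Γ_f`: the convex hull of the union of the sets `ω + (ℝ⁺)^σ`,
where `ω` runs over the support of `f`. -/
def newtonPolyhedron (f : MvPolynomial σ R) : Set (σ → ℝ) :=
  convexHull ℝ {x | ∃ ω ∈ f.support, ∀ i, (ω i : ℝ) ≤ x i}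

/-- `τ` is a face of `Γ`: either `τ = Γ`, or `τ` is a proper face, i.e. the intersection of `Γ`
with a supporting hyperplane `{x | a ⬝ᵥ x = c}` (which meets `Γ` and has `Γ` on one side). -/
def IsFace (Γ τ : Set (σ → ℝ)) : Prop :=
  τ = Γ ∨ ∃ (a : σ → ℝ) (c : ℝ), a ≠ 0 ∧ (∀ x ∈ Γ, c ≤ a ⬝ᵥ x) ∧
    τ = {x ∈ Γ | a ⬝ᵥ x = c} ∧ τ.Nonempty

open Classical in
/-- The face polynomial `f_τ`: the sum of the terms of `f` with exponent in `τ`. -/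
def facePoly (f : MvPolynomial σ R) (τ : Set (σ → ℝ)) : MvPolynomial σ R :=
  ∑ ω ∈ f.support.filter (fun ω : σ →₀ ℕ => toReal ω ∈ τ),
    MvPolynomial.monomial ω (f.coeff ω)

/-- `m_f(a)`, the infimum of `a ⬝ᵥ x` for `x` in the Newton polyhedron. -/
def minDot (f : MvPolynomial σ R) (a : σ → ℝ) : ℝ :=
  sInf ((fun x => a ⬝ᵥ x) '' newtonPolyhedron f)

/-- The first meet locus `F_f(a)`. -/
def firstMeetLocus (f : MvPolynomial σ R) (a : σ → ℝ) : Set (σ → ℝ) :=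
  {x ∈ newtonPolyhedron f | a ⬝ᵥ x = minDot f a}

/-- The cone `Δ_{f,τ}` associated to `τ`. -/
def faceCone (f : MvPolynomial σ R) (τ : Set (σ → ℝ)) : Set (σ → ℝ) :=
  {a | (∀ i, 0 ≤ a i) ∧ firstMeetLocus f a = τ}

/-- `m_f(a)` for `a ∈ ℕ^σ`, as a natural number; see `coe_minDotNat`. -/
def minDotNat (f : MvPolynomial σ R) (a : σ → ℕ) : ℕ :=
  ⌊minDot f (toReal a)⌋₊

/-- For a nonzero polynomial and a vector of natural numbers, `m_f(a)` is a natural number. -/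
theorem coe_minDotNat (f : MvPolynomial σ R) (hf : f ≠ 0) (a : σ → ℕ) :
    (minDotNat f a : ℝ) = minDot f (toReal a) := by
  obtain ⟨ω, hω, hmin⟩ := f.support.exists_min_image (fun ω => ∑ i, a i * ω i)
    (Finset.nonempty_iff_ne_empty.mpr (by simpa using hf))
  have hleast : IsLeast ((fun x => toReal a ⬝ᵥ x) '' newtonPolyhedron f)
      ((∑ i, a i * ω i : ℕ) : ℝ) := by
    constructor
    · refine ⟨toReal ω, subset_convexHull ℝ _ ⟨ω, hω, fun i => le_rfl⟩, ?_⟩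
      simp [dotProduct, toReal]
    · rintro _ ⟨x, hx, rfl⟩
      have hsub : newtonPolyhedron f ⊆
          {x | ((∑ i, a i * ω i : ℕ) : ℝ) ≤ toReal a ⬝ᵥ x} := by
        refine convexHull_min ?_ ?_
        · rintro y ⟨η, hη, hy⟩
          calc ((∑ i, a i * ω i : ℕ) : ℝ) ≤ ((∑ i, a i * η i : ℕ) : ℝ) := by
                exact_mod_cast hmin η hη
            _ ≤ toReal a ⬝ᵥ y := by
                push_cast
                exact Finset.sum_le_sum fun i _ =>
                  mul_le_mul_of_nonneg_left (hy i) (Nat.cast_nonneg _)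
        · exact convex_halfSpace_ge (f := fun x => toReal a ⬝ᵥ x)
            ⟨fun x y => dotProduct_add _ x y, fun c x => dotProduct_smul c _ x⟩ _
      exact hsub hx
  unfold minDotNat minDot
  rw [hleast.csInf_eq, Nat.floor_natCast]

/-- `⊕ ℕ a_i`, the set of linear combinations of the `a_i` with coefficients in `ℕ`. -/
def latticeCone {u : ℕ} (a : Fin u → σ → ℕ) : Set (σ → ℝ) :=
  {x | ∃ k : Fin u → ℕ, x = ∑ i, k i • toReal (a i)}

/-- The function `c_{a,b}` attached to `f`, `g`: it is `-l s - e |b| - e' |a|` if `m_f(a)` and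
`m_g(b)` are positive, where `l`, `e`, `e'` are the least common multiple and the two cofactors,
and it is `-∞` otherwise. -/
def cFun {ρ : Type*} [Fintype ρ] (f : MvPolynomial σ R) (g : MvPolynomial ρ R)
    (a : σ → ℕ) (b : ρ → ℕ) (s : ℂ) : WithBot ℂ :=
  let c := minDotNat f a
  let d := minDotNat g b
  if 0 < c ∧ 0 < d then
    ((-(Nat.lcm c d : ℂ) * s - ((c / Nat.gcd c d : ℕ) : ℂ) * ((∑ j, b j : ℕ) : ℂ)
      - ((d / Nat.gcd c d : ℕ) : ℂ) * ((∑ i, a i : ℕ) : ℂ) : ℂ) : WithBot ℂ)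
  else ⊥

/-- `q ^ c` for `c ∈ ℂ ∪ {-∞}`, with `q ^ (-∞) = 0`. -/
def qpow (q : ℕ) : WithBot ℂ → ℂ
  | ⊥ => 0
  | (c : ℂ) => (q : ℂ) ^ c

/-- The sum `f(x) + g(y)` in separated variables. -/
def directSum {ρ : Type*} (f : MvPolynomial σ R) (g : MvPolynomial ρ R) :
    MvPolynomial (σ ⊕ ρ) R :=
  MvPolynomial.rename Sum.inl f + MvPolynomial.rename Sum.inr g

/-- The product `A × B` inside `ℝ^(σ ⊕ ρ)`. -/
def prodSet {ρ : Type*} (A : Set (σ → ℝ)) (B : Set (ρ → ℝ)) : Set (σ ⊕ ρ → ℝ) :=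
  {w | w ∘ Sum.inl ∈ A ∧ w ∘ Sum.inr ∈ B}

end Newton

section Local

variable (K : Type*) [Field K] [ValuativeRel K] [TopologicalSpace K]
  [IsNonarchimedeanLocalField K]

/-- The cardinality `q` of the residue field. -/
def resCard : ℕ := Nat.card 𝓀[K]

variable {K}

/-- The order `ord_π` on the ring of integers, with value `∞` at `0`. -/
def ord (x : 𝒪[K]) : ℕ∞ := IsDiscreteValuationRing.addVal 𝒪[K] x

open Classical in
/-- The absolute value `|x| = q ^ (-ord x)` on the ring of integers, with `|0| = 0`. -/
def absO (x : 𝒪[K]) : ℝ :=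
  if x = 0 then 0 else ((resCard K : ℝ) ^ (ord x).toNat)⁻¹

/-- `f` is Newton non-critical: for every face `τ` of its Newton polyhedron, the partial
derivatives of `f_τ` have no common zero in `(K^×)^σ`. -/
def NewtonNonCritical {σ : Type*} [Fintype σ] (f : MvPolynomial σ 𝒪[K]) : Prop :=
  ∀ τ : Set (σ → ℝ), IsFace (newtonPolyhedron f) τ →
    ¬ ∃ x : σ → K, (∀ i, x i ≠ 0) ∧
      ∀ i, MvPolynomial.aeval x (MvPolynomial.pderiv i (facePoly f τ)) = 0

/-- `E_A`: the points of `𝒪^σ` whose vector of orders lies in `A` (in particular it is finite). -/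
def orderSet {σ : Type*} (A : Set (σ → ℝ)) : Set (σ → 𝒪[K]) :=
  {x | ∃ k : σ → ℕ, (∀ i, ord (x i) = (k i : ℕ∞)) ∧ toReal k ∈ A}

variable [MeasurableSpace K] [BorelSpace K]

variable (K) in
/-- The Haar measure on the compact open additive group `𝒪`, of total mass `1`; it is the
restriction to `𝒪` of the Haar measure of `K` for which `𝒪` has measure `1`. -/
def haarO : Measure 𝒪[K] := Measure.addHaarMeasure ⊤

variable (K) in
/-- The normalized Haar measure `|dx|` on `𝒪^σ`. -/
def haarPi (σ : Type*) [Fintype σ] : Measure (σ → 𝒪[K]) := Measure.pi fun _ => haarO K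

/-- The integrand `|h(x)|^s`. -/
def zetaIntegrand {σ : Type*} (h : MvPolynomial σ 𝒪[K]) (s : ℂ) (x : σ → 𝒪[K]) : ℂ :=
  (absO (MvPolynomial.eval x h) : ℂ) ^ s

/-- `Z_A(h; s)`, the integral of `|h(x)|^s |dx|` over `E_A`. -/
def zeta {σ : Type*} [Fintype σ] (A : Set (σ → ℝ)) (h : MvPolynomial σ 𝒪[K]) (s : ℂ) : ℂ :=
  ∫ x in orderSet A, zetaIntegrand h s x ∂(haarPi K σ)

end Local

end NewtonIgusa

end

open NewtonIgusa

/-! Write `q` for the residue cardinality and `T = q^(-s)`. By linear independence the domain is the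
disjoint union, over `(k, l)` in `ℕ^u × ℕ^v`, of the shells where the coordinates have orders `κ = ∑
k_i a_i` and `λ = ∑ l_j b_j`. On a shell substitute `π^κ x`, `π^λ y` with unit coordinates. Every
exponent of `f_τ` has the same pairing `m_f(a_i)` with `a_i`, so `f_τ` acquires the factor `π^A`
with `A = ∑ k_i m_f(a_i)`, and `g_γ` similarly a factor `π^B`. The shell contributes `q^(-|κ|-|λ|)
I(A, B)`, where `I(A, B)` integrates `|π^A f_τ + π^B g_γ|^s` over unit vectors.

Non-criticality and compactness bound the gradients from below on unit vectors, so small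
translations equidistribute the values modulo high powers of `π`
(`exists_measureReal_pow_dvd_succ`). Hence `(1 - q⁻¹T) I(A, B)` is a polynomial `w(A, B)` in `T`.
Moreover `w(d, 0)` and `w(0, d)` are constant for large `d`, because a perturbation divisible by a
high power of `π` does not change the distribution of values. Taking out a common factor `π` gives
`w(A+1, B+1) = T w(A, B)`. This is `exists_isWeight_setIntegral`.

It remains to sum `q^(-|κ|-|λ|) w(A, B)` (`monoidSum_isRatPoly`). If `α = m_f(a)` and `β = m_g(b)`
are positive, adding `β/gcd` copies of `a` and `α/gcd` copies of `b` raises both arguments by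
`lcm(α, β)` and multiplies a term by exactly `q^c`. So `(1 - q^c)` times the series is a finite
combination of series with one generator fewer. The induction stops when one family is empty; there
the stability on the axes leaves finite sums and constant geometric series. -/

namespace NewtonIgusa

/-! ### Generating series over `ℕ^u × ℕ^v` -/

section Combinatorics

/-- A function that is given on the open unit disc by a polynomial with rational coefficients. -/
def IsRatPoly (F : ℂ → ℂ) : Prop :=
  ∃ P : ℚ[X], ∀ T : ℂ, ‖T‖ < 1 → F T = Polynomial.aeval T P

namespace IsRatPoly

theorem aeval (P : ℚ[X]) : IsRatPoly fun T => Polynomial.aeval T P :=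
  ⟨P, fun _ _ => rfl⟩

theorem congr {F G : ℂ → ℂ} (hF : IsRatPoly F) (h : ∀ T : ℂ, ‖T‖ < 1 → G T = F T) :
    IsRatPoly G := by
  obtain ⟨P, hP⟩ := hF
  exact ⟨P, fun T hT => (h T hT).trans (hP T hT)⟩

theorem const (c : ℚ) : IsRatPoly fun _ => (c : ℂ) :=
  ⟨Polynomial.C c, fun T _ => by simp⟩

theorem add {F G : ℂ → ℂ} (hF : IsRatPoly F) (hG : IsRatPoly G) :
    IsRatPoly fun T => F T + G T := by
  obtain ⟨P, hP⟩ := hF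
  obtain ⟨Q, hQ⟩ := hG
  exact ⟨P + Q, fun T hT => by simp [hP T hT, hQ T hT]⟩

theorem mul {F G : ℂ → ℂ} (hF : IsRatPoly F) (hG : IsRatPoly G) :
    IsRatPoly fun T => F T * G T := by
  obtain ⟨P, hP⟩ := hF
  obtain ⟨Q, hQ⟩ := hG
  exact ⟨P * Q, fun T hT => by simp [hP T hT, hQ T hT]⟩

theorem sum {ι : Type*} (s : Finset ι) {F : ι → ℂ → ℂ} (hF : ∀ i ∈ s, IsRatPoly (F i)) :
    IsRatPoly fun T => ∑ i ∈ s, F i T := by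
  classical
  induction s using Finset.induction_on with
  | empty => simpa using const 0
  | insert i s hi ih =>
    simp only [Finset.sum_insert hi]
    exact (hF i (by simp)).add (ih fun j hj => hF j (by simp [hj]))

theorem prod {ι : Type*} (s : Finset ι) {F : ι → ℂ → ℂ} (hF : ∀ i ∈ s, IsRatPoly (F i)) :
    IsRatPoly fun T => ∏ i ∈ s, F i T := by
  classical
  induction s using Finset.induction_on with
  | empty => simpa using const 1
  | insert i s hi ih =>
    simp only [Finset.prod_insert hi]
    exact (hF i (by simp)).mul (ih fun j hj => hF j (by simp [hj]))

theorem invPow (q k : ℕ) : IsRatPoly fun _ => ((q : ℂ)⁻¹) ^ k :=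
  (const ((q : ℚ)⁻¹ ^ k)).congr fun T _ => by push_cast; rfl

end IsRatPoly

/-- The factor `q ^ c` attached to a pair of generators with values `(p, α)` and `(r, β)`,
as a function of `T = q ^ (-s)`. -/
noncomputable def rayFactor (q p α r β : ℕ) (T : ℂ) : ℂ :=
  if 0 < α ∧ 0 < β then
    ((q : ℂ)⁻¹) ^ (β / α.gcd β * p + α / α.gcd β * r) * T ^ α.lcm β
  else 0

theorem isRatPoly_rayFactor (q p α r β : ℕ) : IsRatPoly fun T => 1 - rayFactor q p α r β T := by
  unfold rayFactor
  split_ifs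
  · refine ⟨1 - Polynomial.C ((q : ℚ)⁻¹ ^ (β / α.gcd β * p + α / α.gcd β * r)) *
      Polynomial.X ^ α.lcm β, fun T _ => ?_⟩
    simp
  · simpa using IsRatPoly.const 1

/-- The series `∑ q ^ (-∑ k_i p_i - ∑ l_j r_j) φ(∑ k_i α_i, ∑ l_j β_j)`. -/
noncomputable def monoidSum (q : ℕ) {u v : ℕ} (p α : Fin u → ℕ) (r β : Fin v → ℕ)
    (φ : ℕ → ℕ → ℂ) : ℂ :=
  ∑' x : (Fin u → ℕ) × (Fin v → ℕ),
    ((q : ℂ)⁻¹) ^ (∑ i, x.1 i * p i + ∑ j, x.2 j * r j) *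
      φ (∑ i, x.1 i * α i) (∑ j, x.2 j * β j)

theorem summable_pi_pow {c : ℝ} (h0 : 0 ≤ c) (h1 : c < 1) {u : ℕ} (p : Fin u → ℕ)
    (hp : ∀ i, 0 < p i) : Summable fun k : Fin u → ℕ => c ^ ∑ i, k i * p i := by
  induction u with
  | zero => exact Summable.of_finite
  | succ u ih =>
    rw [← (Fin.consEquiv fun _ => ℕ).summable_iff]
    have h2 : Summable fun k : ℕ => c ^ (k * p 0) := by
      simp_rw [mul_comm _ (p 0), pow_mul]
      exact summable_geometric_of_lt_one (by positivity) (pow_lt_one₀ h0 h1 (hp 0).ne')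
    refine (h2.mul_of_nonneg (ih (fun i => p i.succ) fun i => hp _) (fun _ => by positivity)
      fun _ => by positivity).congr fun x => ?_
    simp [Fin.consEquiv, Fin.sum_univ_succ, pow_add]

/-- Boundedness of a function of two natural numbers. -/
def IsBdd (φ : ℕ → ℕ → ℂ) : Prop := ∃ C, ∀ A B, ‖φ A B‖ ≤ C

theorem IsBdd.shift {φ : ℕ → ℕ → ℂ} (h : IsBdd φ) (c d : ℕ) :
    IsBdd fun A B => φ (A + c) (B + d) := by
  obtain ⟨C, hC⟩ := h
  exact ⟨C, fun _ _ => hC _ _⟩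

theorem IsBdd.swap {φ : ℕ → ℕ → ℂ} (h : IsBdd φ) : IsBdd fun A B => φ B A := by
  obtain ⟨C, hC⟩ := h
  exact ⟨C, fun _ _ => hC _ _⟩

section

variable {q : ℕ} (hq : 1 < q) {u v : ℕ}
include hq

theorem summable_monoidSum (p α : Fin u → ℕ) (r β : Fin v → ℕ) (hp : ∀ i, 0 < p i)
    (hr : ∀ j, 0 < r j) {φ : ℕ → ℕ → ℂ} (hφ : IsBdd φ) :
    Summable fun x : (Fin u → ℕ) × (Fin v → ℕ) =>
      ((q : ℂ)⁻¹) ^ (∑ i, x.1 i * p i + ∑ j, x.2 j * r j) *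
        φ (∑ i, x.1 i * α i) (∑ j, x.2 j * β j) := by
  obtain ⟨C, hC⟩ := hφ
  have hq' : (1 : ℝ) < q := by exact_mod_cast hq
  have h1 : (q : ℝ)⁻¹ < 1 := inv_lt_one_of_one_lt₀ hq'
  refine Summable.of_norm_bounded (g := fun x : (Fin u → ℕ) × (Fin v → ℕ) =>
    (((q : ℝ)⁻¹) ^ (∑ i, x.1 i * p i) * ((q : ℝ)⁻¹) ^ (∑ j, x.2 j * r j)) * C) ?_ fun x => ?_
  · exact ((summable_pi_pow (by positivity) h1 p hp).mul_of_nonneg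
      (summable_pi_pow (by positivity) h1 r hr) (fun _ => by positivity)
      fun _ => by positivity).mul_right C
  · rw [norm_mul, norm_pow, norm_inv, Complex.norm_natCast, pow_add]
    exact mul_le_mul_of_nonneg_left (hC _ _) (by positivity)

/-- Separate the terms with `k_0 = 0`; in the others, remove one copy of the first generator.
Boundedness of `φ` supplies the absolute convergence needed to sum over `k_0` last. -/
theorem monoidSum_succ (p α : Fin (u + 1) → ℕ) (r β : Fin v → ℕ) (hp : ∀ i, 0 < p i)
    (hr : ∀ j, 0 < r j) {φ : ℕ → ℕ → ℂ} (hφ : IsBdd φ) :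
    monoidSum q p α r β φ = monoidSum q (Fin.tail p) (Fin.tail α) r β φ +
      ((q : ℂ)⁻¹) ^ p 0 * monoidSum q p α r β (fun A B => φ (A + α 0) B) := by
  have key : ∀ ψ : ℕ → ℕ → ℂ, IsBdd ψ →
      (Summable fun k : ℕ => ((q : ℂ)⁻¹) ^ (k * p 0) *
        monoidSum q (Fin.tail p) (Fin.tail α) r β (fun A B => ψ (A + k * α 0) B)) ∧
      monoidSum q p α r β ψ = ∑' k : ℕ, ((q : ℂ)⁻¹) ^ (k * p 0) *
        monoidSum q (Fin.tail p) (Fin.tail α) r β (fun A B => ψ (A + k * α 0) B) := by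
    intro ψ hψ
    let e : ℕ × ((Fin u → ℕ) × (Fin v → ℕ)) ≃ (Fin (u + 1) → ℕ) × (Fin v → ℕ) :=
      (Equiv.prodAssoc _ _ _).symm.trans ((Fin.consEquiv fun _ => ℕ).prodCongr (Equiv.refl _))
    have hs := summable_monoidSum hq p α r β hp hr hψ
    rw [← e.summable_iff] at hs
    have hk : ∀ k : ℕ, ∑' y : (Fin u → ℕ) × (Fin v → ℕ), ((fun x : (Fin (u + 1) → ℕ) × (Fin v → ℕ) =>
        ((q : ℂ)⁻¹) ^ (∑ i, x.1 i * p i + ∑ j, x.2 j * r j) *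
          ψ (∑ i, x.1 i * α i) (∑ j, x.2 j * β j)) ∘ e) (k, y) =
        ((q : ℂ)⁻¹) ^ (k * p 0) *
        monoidSum q (Fin.tail p) (Fin.tail α) r β (fun A B => ψ (A + k * α 0) B) := by
      intro k
      rw [monoidSum, ← tsum_mul_left]
      refine tsum_congr fun y => ?_
      simp only [e, Function.comp, Equiv.trans_apply, Equiv.prodAssoc_symm_apply,
        Equiv.prodCongr_apply, Prod.map, Fin.consEquiv, Equiv.coe_fn_mk, Fin.sum_univ_succ,
        Fin.cons_zero, Fin.cons_succ, Equiv.refl_apply, Fin.tail]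
      rw [add_comm (k * α 0), ← mul_assoc, ← pow_add, add_assoc]
    constructor
    · exact hs.prod.congr fun k => (hk k)
    · rw [monoidSum, ← e.tsum_eq]
      refine (hs.tsum_prod).trans ?_
      exact tsum_congr hk
  obtain ⟨h1, h2⟩ := key φ hφ
  obtain ⟨h3, h4⟩ := key _ (hφ.shift (α 0) 0)
  rw [h2, h1.tsum_eq_zero_add]
  simp only [add_zero] at h4
  rw [h4, ← tsum_mul_left]
  congr 1
  · simp
  · refine tsum_congr fun k => ?_
    rw [← mul_assoc, ← pow_add]
    congr 3
    · ring
    · funext A B; congr 1; ring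

theorem monoidSum_split (p α : Fin (u + 1) → ℕ) (r β : Fin v → ℕ) (hp : ∀ i, 0 < p i)
    (hr : ∀ j, 0 < r j) {φ : ℕ → ℕ → ℂ} (hφ : IsBdd φ) (N : ℕ) :
    monoidSum q p α r β φ =
      ∑ k ∈ Finset.range N, ((q : ℂ)⁻¹) ^ (k * p 0) *
        monoidSum q (Fin.tail p) (Fin.tail α) r β (fun A B => φ (A + k * α 0) B) +
      ((q : ℂ)⁻¹) ^ (N * p 0) * monoidSum q p α r β (fun A B => φ (A + N * α 0) B) := by
  induction N with
  | zero => simp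
  | succ N ih =>
    have := monoidSum_succ hq p α r β hp hr (hφ.shift (N * α 0) 0)
    simp only [add_zero] at this
    rw [ih, Finset.sum_range_succ, this, mul_add, ← mul_assoc, ← pow_add, add_assoc]
    congr 3
    · ring
    · congr 1; funext A B; congr 1; ring

end

theorem monoidSum_swap (q : ℕ) {u v : ℕ} (p α : Fin u → ℕ) (r β : Fin v → ℕ) (φ : ℕ → ℕ → ℂ) :
    monoidSum q p α r β φ = monoidSum q r β p α (fun A B => φ B A) := by
  rw [monoidSum, ← (Equiv.prodComm (Fin v → ℕ) (Fin u → ℕ)).tsum_eq, monoidSum]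
  refine tsum_congr fun x => ?_
  simp [add_comm]

theorem monoidSum_const_mul (q : ℕ) {u v : ℕ} (p α : Fin u → ℕ) (r β : Fin v → ℕ) (c : ℂ)
    (φ : ℕ → ℕ → ℂ) :
    monoidSum q p α r β (fun A B => c * φ A B) = c * monoidSum q p α r β φ := by
  simp only [monoidSum, ← tsum_mul_left]
  refine tsum_congr fun x => ?_
  ring

theorem monoidSum_zero_zero (q : ℕ) (p α r β : Fin 0 → ℕ) (φ : ℕ → ℕ → ℂ) :
    monoidSum q p α r β φ = φ 0 0 := by
  simp [monoidSum]

end Combinatorics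

/-! ### Weights and the elimination of generators -/

section Weights

/-- Polynomial weights `w(A, B)` that are homogeneous along the diagonal and constant far away
on both axes. -/
structure IsWeight (w : ℕ → ℕ → ℚ[X]) : Prop where
  diag : ∀ A B, w (A + 1) (B + 1) = Polynomial.X * w A B
  left : ∃ D, ∀ d, D ≤ d → w d 0 = w D 0
  right : ∃ D, ∀ d, D ≤ d → w 0 d = w 0 D

namespace IsWeight

variable {w : ℕ → ℕ → ℚ[X]}

theorem swap (hw : IsWeight w) : IsWeight fun A B => w B A :=
  ⟨fun A B => hw.diag B A, hw.right, hw.left⟩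

theorem diag_add (hw : IsWeight w) (c A B : ℕ) :
    w (A + c) (B + c) = Polynomial.X ^ c * w A B := by
  induction c with
  | zero => simp
  | succ c ih => rw [← add_assoc, ← add_assoc, hw.diag, ih, pow_succ']; ring

theorem shift_left (hw : IsWeight w) (c : ℕ) : IsWeight fun A B => w (A + c) B := by
  refine ⟨fun A B => ?_, ?_, ?_⟩
  · rw [← hw.diag]; congr 1; ring
  · obtain ⟨D, hD⟩ := hw.left
    exact ⟨D, fun d hd => (hD _ (by omega)).trans (hD _ (by omega)).symm⟩
  · obtain ⟨D, hD⟩ := hw.right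
    -- For `d = D + c + e`, the diagonal relation turns the point `(c, d)` into `X^c` times the
    -- value at `(0, D + e)`, which is in the stable range.
    refine ⟨D + c, fun d hd => ?_⟩
    obtain ⟨e, rfl⟩ := Nat.exists_eq_add_of_le hd
    have h1 := hw.diag_add c 0 (D + e)
    have h2 := hw.diag_add c 0 D
    rw [hD _ (by omega)] at h1
    rw [show D + c + e = D + e + c by ring, h1, h2]

theorem shift (hw : IsWeight w) (c d : ℕ) : IsWeight fun A B => w (A + c) (B + d) :=
  (hw.shift_left c).swap.shift_left d |>.swap

/-- Every point lies on a diagonal through an axis; moving along it multiplies by a power of `T`, of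
norm at most one, and each axis carries only finitely many values. -/
theorem isBdd (hw : IsWeight w) {T : ℂ} (hT : ‖T‖ < 1) :
    IsBdd fun A B => Polynomial.aeval T (w A B) := by
  have main : ∀ w' : ℕ → ℕ → ℚ[X], IsWeight w' →
      ∃ C, ∀ A B, ‖Polynomial.aeval T (w' (B + A) B)‖ ≤ C := by
    intro w' hw'
    obtain ⟨D, hD⟩ := hw'.left
    refine ⟨∑ d ∈ Finset.range (D + 1), ‖Polynomial.aeval T (w' d 0)‖, fun A B => ?_⟩
    have h1 : ‖Polynomial.aeval T (w' A 0)‖ ≤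
        ∑ d ∈ Finset.range (D + 1), ‖Polynomial.aeval T (w' d 0)‖ := by
      have h2 : ∀ d ∈ Finset.range (D + 1), ‖Polynomial.aeval T (w' d 0)‖ ≤
          ∑ d ∈ Finset.range (D + 1), ‖Polynomial.aeval T (w' d 0)‖ := fun d hd =>
        Finset.single_le_sum (f := fun d => ‖Polynomial.aeval T (w' d 0)‖)
          (fun _ _ => norm_nonneg _) hd
      by_cases h : A ≤ D
      · exact h2 A (by simp; omega)
      · rw [hD A (by omega)]
        exact h2 D (by simp)
    have h3 := hw'.diag_add B A 0
    rw [zero_add, add_comm A B] at h3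
    rw [h3, map_mul, map_pow, Polynomial.aeval_X, norm_mul, norm_pow]
    exact (mul_le_of_le_one_left (norm_nonneg _) (pow_le_one₀ (norm_nonneg _) hT.le)).trans h1
  obtain ⟨C, hC⟩ := main w hw
  obtain ⟨C', hC'⟩ := main _ hw.swap
  refine ⟨max C C', fun A B => ?_⟩
  rcases le_total B A with h | h
  · obtain ⟨c, rfl⟩ := Nat.exists_eq_add_of_le h
    exact (hC c B).trans (le_max_left _ _)
  · obtain ⟨c, rfl⟩ := Nat.exists_eq_add_of_le h
    exact (hC' c A).trans (le_max_right _ _)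

end IsWeight

theorem isRatPoly_inv_one_sub_invPow (q k : ℕ) :
    IsRatPoly fun _ => ((1 : ℂ) - ((q : ℂ)⁻¹) ^ k)⁻¹ :=
  (IsRatPoly.const ((1 - ((q : ℚ)⁻¹) ^ k)⁻¹)).congr fun T _ => by push_cast; rfl

variable {q : ℕ} (hq : 1 < q)
include hq

theorem one_sub_invPow_ne_zero {k : ℕ} (hk : 0 < k) : (1 : ℂ) - ((q : ℂ)⁻¹) ^ k ≠ 0 := by
  intro h
  have h1 : ‖((q : ℂ)⁻¹) ^ k‖ < 1 := by
    rw [norm_pow, norm_inv, Complex.norm_natCast]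
    exact pow_lt_one₀ (by positivity) (inv_lt_one_of_one_lt₀ (by exact_mod_cast hq)) hk.ne'
  rw [← sub_eq_zero.mp h] at h1
  simp at h1

theorem monoidSum_one_isRatPoly {u : ℕ} (p α : Fin u → ℕ) (r β : Fin 0 → ℕ)
    (hp : ∀ i, 0 < p i) : IsRatPoly fun _ => monoidSum q p α r β fun _ _ => 1 := by
  induction u with
  | zero => simpa [monoidSum_zero_zero] using IsRatPoly.const 1
  | succ u ih =>
    refine ((isRatPoly_inv_one_sub_invPow q (p 0)).mul
      (ih (Fin.tail p) (Fin.tail α) fun i => hp _)).congr fun T _ => ?_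
    have h := monoidSum_succ hq p α r β hp (fun j => j.elim0) (φ := fun _ _ => 1) ⟨1, by simp⟩
    rw [eq_inv_mul_iff_mul_eq₀ (one_sub_invPow_ne_zero hq (hp 0)), sub_mul, one_mul]
    linear_combination h

theorem monoidSum_of_eq_zero {u v : ℕ} (p α : Fin (u + 1) → ℕ) (r β : Fin v → ℕ)
    (hp : ∀ i, 0 < p i) (hr : ∀ j, 0 < r j) {φ : ℕ → ℕ → ℂ} (hφ : IsBdd φ) (h0 : α 0 = 0) :
    monoidSum q p α r β φ =
      (1 - ((q : ℂ)⁻¹) ^ p 0)⁻¹ * monoidSum q (Fin.tail p) (Fin.tail α) r β φ := by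
  have h := monoidSum_succ hq p α r β hp hr hφ
  simp only [h0, add_zero] at h
  rw [eq_inv_mul_iff_mul_eq₀ (one_sub_invPow_ne_zero hq (hp 0)), sub_mul, one_mul]
  linear_combination h

/-- With no right generators the weight is evaluated on one axis only. After `D` copies of a
generator with positive value it has become constant, so what is left is a product of numerical
geometric series and no factor depending on `T` is needed. -/
theorem monoidSum_left_isRatPoly {u : ℕ} (p α : Fin u → ℕ) (r β : Fin 0 → ℕ)
    (hp : ∀ i, 0 < p i) {w : ℕ → ℕ → ℚ[X]} (hw : IsWeight w) :
    IsRatPoly fun T => monoidSum q p α r β fun A B => Polynomial.aeval T (w A B) := by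
  induction u generalizing w with
  | zero => simpa [monoidSum_zero_zero] using IsRatPoly.aeval _
  | succ u ih =>
    rcases Nat.eq_zero_or_pos (α 0) with h0 | h0
    · exact ((isRatPoly_inv_one_sub_invPow q (p 0)).mul
        (ih (Fin.tail p) (Fin.tail α) (fun i => hp _) hw)).congr fun T hT =>
          monoidSum_of_eq_zero hq p α r β hp (fun j => j.elim0) (hw.isBdd hT) h0
    · obtain ⟨D, hD⟩ := hw.left
      refine ((IsRatPoly.sum (Finset.range D) fun k _ => (IsRatPoly.invPow q (k * p 0)).mul
        (ih (Fin.tail p) (Fin.tail α) (fun i => hp _) (hw.shift_left (k * α 0)))).add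
        ((IsRatPoly.invPow q (D * p 0)).mul ((IsRatPoly.aeval (w D 0)).mul
          (monoidSum_one_isRatPoly hq p α r β hp)))).congr fun T hT => ?_
      rw [monoidSum_split hq p α r β hp (fun j => j.elim0) (hw.isBdd hT) D,
        ← monoidSum_const_mul q p α r β (Polynomial.aeval T (w D 0))]
      refine congrArg₂ (· + ·) rfl (congrArg (_ * ·) ?_)
      rw [monoidSum, monoidSum]
      refine tsum_congr fun x => ?_
      congr 1
      simp only [Finset.univ_eq_empty, Finset.sum_empty, mul_one]
      rw [hD]
      exact le_add_left (Nat.le_mul_of_pos_right D h0)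

theorem monoidSum_split_right {u v : ℕ} (p α : Fin u → ℕ) (r β : Fin (v + 1) → ℕ)
    (hp : ∀ i, 0 < p i) (hr : ∀ j, 0 < r j) {φ : ℕ → ℕ → ℂ} (hφ : IsBdd φ) (N : ℕ) :
    monoidSum q p α r β φ =
      ∑ k ∈ Finset.range N, ((q : ℂ)⁻¹) ^ (k * r 0) *
        monoidSum q p α (Fin.tail r) (Fin.tail β) (fun A B => φ A (B + k * β 0)) +
      ((q : ℂ)⁻¹) ^ (N * r 0) * monoidSum q p α r β (fun A B => φ A (B + N * β 0)) := by
  rw [monoidSum_swap, monoidSum_split hq r β p α hr hp hφ.swap N, ← monoidSum_swap q p α]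
  congr 1
  exact Finset.sum_congr rfl fun k _ => by rw [← monoidSum_swap q p α]

/-- The generating series of a weight over `ℕ ^ u × ℕ ^ v` becomes a polynomial after
multiplication by the factors attached to the pairs of generators. -/
theorem monoidSum_isRatPoly {u v : ℕ} (p α : Fin u → ℕ) (r β : Fin v → ℕ)
    (hp : ∀ i, 0 < p i) (hr : ∀ j, 0 < r j) {w : ℕ → ℕ → ℚ[X]} (hw : IsWeight w) :
    IsRatPoly fun T => (∏ i, ∏ j, (1 - rayFactor q (p i) (α i) (r j) (β j) T)) *
      monoidSum q p α r β fun A B => Polynomial.aeval T (w A B) := by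
  induction hn : u + v generalizing u v w with
  | zero =>
    obtain ⟨rfl, rfl⟩ : u = 0 ∧ v = 0 := by omega
    simpa using monoidSum_left_isRatPoly hq p α r β hp hw
  | succ n ih =>
    rcases u with _ | u
    · refine (monoidSum_left_isRatPoly hq r β p α hr hw.swap).congr fun T _ => ?_
      simp [monoidSum_swap q p α]
    rcases v with _ | v
    · simpa using monoidSum_left_isRatPoly hq p α r β hp hw
    have hl {w' : ℕ → ℕ → ℚ[X]} (hw' : IsWeight w') :=
      ih (Fin.tail p) (Fin.tail α) r β (fun i => hp _) hr hw' (by omega)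
    have hr' {w' : ℕ → ℕ → ℚ[X]} (hw' : IsWeight w') :=
      ih p α (Fin.tail r) (Fin.tail β) hp (fun i => hr _) hw' (by omega)
    have hrow : IsRatPoly fun T => ∏ j, (1 - rayFactor q (p 0) (α 0) (r j) (β j) T) :=
      IsRatPoly.prod _ fun j _ => isRatPoly_rayFactor ..
    have hrow' : IsRatPoly fun T => ∏ j : Fin v,
        (1 - rayFactor q (p 0) (α 0) (r j.succ) (β j.succ) T) :=
      IsRatPoly.prod _ fun j _ => isRatPoly_rayFactor ..
    have hcol : IsRatPoly fun T => ∏ i, (1 - rayFactor q (p i) (α i) (r 0) (β 0) T) :=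
      IsRatPoly.prod _ fun j _ => isRatPoly_rayFactor ..
    have hcol' : IsRatPoly fun T => ∏ i : Fin u,
        (1 - rayFactor q (p i.succ) (α i.succ) (r 0) (β 0) T) :=
      IsRatPoly.prod _ fun j _ => isRatPoly_rayFactor ..
    -- A generator of value zero does not move the argument of the weight: it contributes a rational
    -- constant `(1 - q^(-p))⁻¹`, hence no new denominator.
    rcases Nat.eq_zero_or_pos (α 0) with hα | hα
    · refine ((hrow.mul (isRatPoly_inv_one_sub_invPow q (p 0))).mul (hl hw)).congr
        fun T hT => ?_
      rw [monoidSum_of_eq_zero hq p α r β hp hr (hw.isBdd hT) hα, Fin.prod_univ_succ]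
      simp only [Fin.tail]
      ring
    rcases Nat.eq_zero_or_pos (β 0) with hβ | hβ
    · refine ((hcol.mul (isRatPoly_inv_one_sub_invPow q (r 0))).mul (hr' hw)).congr
        fun T hT => ?_
      rw [monoidSum_swap, monoidSum_of_eq_zero hq r β p α hr hp (hw.isBdd hT).swap hβ,
        ← monoidSum_swap q p α]
      simp only [Fin.prod_univ_succ (n := v), Finset.prod_mul_distrib, Fin.tail]
      ring
    -- `N` copies of the first left generator and `M` copies of the first right one raise both
    -- arguments by the same amount, the least common multiple.
    obtain ⟨N, hN⟩ : ∃ N, β 0 / (α 0).gcd (β 0) = N := ⟨_, rfl⟩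
    obtain ⟨M, hM⟩ : ∃ M, α 0 / (α 0).gcd (β 0) = M := ⟨_, rfl⟩
    have hNα : N * α 0 = (α 0).lcm (β 0) := by
      rw [← hN, Nat.lcm, mul_comm, Nat.mul_div_assoc _ (Nat.gcd_dvd_right _ _)]
    have hMβ : M * β 0 = (α 0).lcm (β 0) := by
      rw [← hM, Nat.lcm, mul_comm, mul_comm (α 0), Nat.mul_div_assoc _ (Nat.gcd_dvd_left _ _)]
    have h1 : IsRatPoly fun T => ∑ k ∈ Finset.range N, ((q : ℂ)⁻¹) ^ (k * p 0) *
        ((∏ i : Fin u, ∏ j, (1 - rayFactor q (p i.succ) (α i.succ) (r j) (β j) T)) *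
          monoidSum q (Fin.tail p) (Fin.tail α) r β
            fun A B => Polynomial.aeval T (w (A + k * α 0) B)) :=
      IsRatPoly.sum _ fun k _ => (IsRatPoly.invPow q _).mul (hl (hw.shift_left _))
    have h2 : IsRatPoly fun T => ∑ l ∈ Finset.range M, ((q : ℂ)⁻¹) ^ (l * r 0) *
        ((∏ i, ∏ j : Fin v, (1 - rayFactor q (p i) (α i) (r j.succ) (β j.succ) T)) *
          monoidSum q p α (Fin.tail r) (Fin.tail β)
            fun A B => Polynomial.aeval T (w (A + N * α 0) (B + l * β 0))) :=
      IsRatPoly.sum _ fun k _ => (IsRatPoly.invPow q _).mul (hr' (hw.shift _ _))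
    refine ((hrow'.mul h1).add ((hcol'.mul (IsRatPoly.invPow q (N * p 0))).mul h2)).congr
      fun T hT => ?_
    -- Peel off `N` copies on the left, then `M` copies on the right from the shifted remainder. By
    -- `e3` the last remainder is the original series times a power of `T`, and by `e4` its total
    -- coefficient is the ray factor of the pair `(0, 0)`.
    have e1 := monoidSum_split hq p α r β hp hr (hw.isBdd hT) N
    have e2 := monoidSum_split_right hq p α r β hp hr ((hw.shift_left (N * α 0)).isBdd hT) M
    have e3 : monoidSum q p α r β
        (fun A B => Polynomial.aeval T (w (A + N * α 0) (B + M * β 0))) =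
        T ^ (α 0).lcm (β 0) * monoidSum q p α r β fun A B => Polynomial.aeval T (w A B) := by
      rw [← monoidSum_const_mul]
      congr 1
      funext A B
      rw [hNα, hMβ, hw.diag_add]
      simp
    rw [e3] at e2
    rw [e2] at e1
    have e4 : rayFactor q (p 0) (α 0) (r 0) (β 0) T =
        ((q : ℂ)⁻¹) ^ (N * p 0) * ((q : ℂ)⁻¹) ^ (M * r 0) * T ^ (α 0).lcm (β 0) := by
      rw [rayFactor, if_pos ⟨hα, hβ⟩, hN, hM, pow_add]
    simp only [mul_left_comm _ (∏ i : Fin u, ∏ j, (1 - rayFactor q (p i.succ) (α i.succ) (r j) (β j) T)),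
      mul_left_comm _ (∏ i, ∏ j : Fin v, (1 - rayFactor q (p i) (α i) (r j.succ) (β j.succ) T)),
      ← Finset.mul_sum]
    have d1 : ∏ i, ∏ j, (1 - rayFactor q (p i) (α i) (r j) (β j) T) =
        (1 - rayFactor q (p 0) (α 0) (r 0) (β 0) T) *
          (∏ j : Fin v, (1 - rayFactor q (p 0) (α 0) (r j.succ) (β j.succ) T)) *
          ∏ i : Fin u, ∏ j, (1 - rayFactor q (p i.succ) (α i.succ) (r j) (β j) T) := by
      rw [Fin.prod_univ_succ, Fin.prod_univ_succ (n := v)]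
    -- Both sides are the product over all pairs other than `(0, 0)`: once grouped as first row
    -- times the rest, once as first column times the rest. Each grouping suits one of the two
    -- finite sums.
    have d2 : (∏ j : Fin v, (1 - rayFactor q (p 0) (α 0) (r j.succ) (β j.succ) T)) *
          ∏ i : Fin u, ∏ j, (1 - rayFactor q (p i.succ) (α i.succ) (r j) (β j) T) =
        (∏ i : Fin u, (1 - rayFactor q (p i.succ) (α i.succ) (r 0) (β 0) T)) *
          ∏ i, ∏ j : Fin v, (1 - rayFactor q (p i) (α i) (r j.succ) (β j.succ) T) := by
      rw [Fin.prod_univ_succ (n := u)]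
      simp only [Fin.prod_univ_succ (n := v), Finset.prod_mul_distrib]
      ring
    set S := monoidSum q p α r β fun A B => Polynomial.aeval T (w A B)
    rw [mul_add, ← add_assoc, ← mul_assoc, ← mul_assoc, ← e4] at e1
    rw [d1]
    set D1 := ∏ i : Fin u, ∏ j, (1 - rayFactor q (p i.succ) (α i.succ) (r j) (β j) T)
    set D2 := ∏ i, ∏ j : Fin v, (1 - rayFactor q (p i) (α i) (r j.succ) (β j.succ) T)
    set t := rayFactor q (p 0) (α 0) (r 0) (β 0) T
    linear_combination (∏ j : Fin v, (1 - rayFactor q (p 0) (α 0) (r j.succ) (β j.succ) T)) * D1 * e1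
      + (((q : ℂ)⁻¹) ^ (N * p 0) * ∑ l ∈ Finset.range M, ((q : ℂ)⁻¹) ^ (l * r 0) *
          monoidSum q p α (Fin.tail r) (Fin.tail β)
            fun A B => Polynomial.aeval T (w (A + N * α 0) (B + l * β 0))) * d2

end Weights

/-! ### Congruences and Taylor expansion for polynomial values -/

section Ring

variable {R : Type*} [CommRing R]

theorem pow_dvd_eval_sub_eval {σ : Type*} (h : MvPolynomial σ R) {d : R} {x y : σ → R}
    (hxy : ∀ i, d ∣ x i - y i) : d ∣ MvPolynomial.eval x h - MvPolynomial.eval y h := by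
  induction h using MvPolynomial.induction_on with
  | C a => simp
  | add p q hp hq =>
    have := dvd_add hp hq
    simp only [map_add]
    convert this using 1
    ring
  | mul_X p i hp =>
    simp only [map_mul, MvPolynomial.eval_X]
    have := dvd_add (hp.mul_right (x i)) ((hxy i).mul_left (MvPolynomial.eval y p))
    convert this using 1
    ring

theorem exists_eval_add_single {σ : Type*} [DecidableEq σ] (h : MvPolynomial σ R) (i : σ)
    (δ : R) (u : σ → R) : ∃ c, MvPolynomial.eval (Pi.single i δ + u) h =
      MvPolynomial.eval u h + δ * MvPolynomial.eval u (MvPolynomial.pderiv i h) + δ ^ 2 * c := by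
  induction h using MvPolynomial.induction_on with
  | C a => exact ⟨0, by simp⟩
  | add p q hp hq =>
    obtain ⟨c, hc⟩ := hp
    obtain ⟨d, hd⟩ := hq
    exact ⟨c + d, by simp only [map_add, hc, hd]; ring⟩
  | mul_X p j hp =>
    obtain ⟨c, hc⟩ := hp
    by_cases hij : j = i
    · subst hij
      refine ⟨MvPolynomial.eval u (MvPolynomial.pderiv j p) + c * u j + δ * c, ?_⟩
      simp only [map_mul, MvPolynomial.eval_X, hc, Pi.add_apply, Pi.single_eq_same,
        Derivation.leibniz, MvPolynomial.pderiv_X_self, smul_eq_mul, map_add, map_one]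
      ring
    · refine ⟨c * u j, ?_⟩
      simp only [map_mul, MvPolynomial.eval_X, hc, Pi.add_apply, Pi.single_eq_of_ne hij,
        Derivation.leibniz, MvPolynomial.pderiv_X_of_ne hij, smul_eq_mul, map_add, map_zero]
      ring

end Ring

/-! ### Compact discrete valuation rings -/

section Compact

variable {R : Type*} [CommRing R] [IsDomain R] [IsDiscreteValuationRing R] [TopologicalSpace R]
  [IsTopologicalRing R] [CompactSpace R] [T2Space R] {π : R} (hπ : Irreducible π)
include hπ

omit [TopologicalSpace R] [IsTopologicalRing R] [CompactSpace R] [T2Space R] in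
theorem eq_zero_of_forall_pow_dvd {x : R} (h : ∀ e, π ^ e ∣ x) : x = 0 := by
  by_contra hx
  obtain ⟨k, hk⟩ := IsDiscreteValuationRing.associated_pow_irreducible hx hπ
  have h1 := (h (k + 1)).trans hk.dvd
  have := (pow_dvd_pow_iff hπ.ne_zero hπ.not_isUnit).mp h1
  omega

omit [TopologicalSpace R] [IsTopologicalRing R] [CompactSpace R] [T2Space R] in
theorem dvd_pow_of_not_pow_dvd {x : R} {e : ℕ} (h : ¬ π ^ e ∣ x) : x ∣ π ^ e := by
  have hx : x ≠ 0 := by rintro rfl; simp at h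
  obtain ⟨k, hk⟩ := IsDiscreteValuationRing.associated_pow_irreducible hx hπ
  rcases le_total k e with h1 | h1
  · exact hk.dvd.trans (pow_dvd_pow _ h1)
  · exact absurd ((pow_dvd_pow _ h1).trans hk.symm.dvd) h

omit [TopologicalSpace R] [IsTopologicalRing R] [CompactSpace R] [T2Space R] in
theorem isUnit_iff_not_dvd {x : R} : IsUnit x ↔ ¬ π ∣ x := by
  constructor
  · exact fun h h' => hπ.not_isUnit (isUnit_of_dvd_unit h' h)
  · intro h
    have := dvd_pow_of_not_pow_dvd hπ (e := 1) (x := x) (by simpa using h)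
    rw [pow_one] at this
    rcases hπ.dvd_iff.mp this with h1 | h1
    · exact h1
    · exact absurd h1.dvd h

theorem isClopen_pow_dvd (j : ℕ) : IsClopen {x : R | π ^ j ∣ x} := by
  have h1 : {x : R | π ^ j ∣ x} = (Ideal.span {π ^ j} : Ideal R) := by
    ext x; simp [Ideal.mem_span_singleton]
  rw [h1]
  have h2 : IsOpen ((Ideal.span {π ^ j} : Ideal R) : Set R) :=
    IsDiscreteValuationRing.isOpen_iff.mpr (by simp [hπ.ne_zero])
  exact ⟨AddSubgroup.isClosed_of_isOpen (Ideal.span {π ^ j} : Ideal R).toAddSubgroup h2, h2⟩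

/-- If no ideal `(π^j)` were inside an open `V` around zero, the nested nonempty compact sets `(π^j)
\ V` would have a common point, necessarily zero, which lies in `V`. -/
theorem hasBasis_nhds_zero_pow_dvd :
    (nhds (0 : R)).HasBasis (fun _ : ℕ => True) fun j => {x | π ^ j ∣ x} := by
  refine ⟨fun t => ⟨fun ht => ?_, ?_⟩⟩
  · obtain ⟨V, hVt, hV, h0⟩ := mem_nhds_iff.mp ht
    by_contra hcon
    push Not at hcon
    have := IsCompact.nonempty_iInter_of_sequence_nonempty_isCompact_isClosed
      (fun j => {x : R | π ^ j ∣ x} ∩ Vᶜ)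
      (fun j => Set.inter_subset_inter_left _ fun x hx => (pow_dvd_pow π j.le_succ).trans hx)
      (fun j => by
        obtain ⟨x, hx, hxt⟩ := Set.not_subset.mp (hcon j trivial)
        exact ⟨x, hx, fun h => hxt (hVt h)⟩)
      (((isClopen_pow_dvd hπ 0).isClosed.inter hV.isClosed_compl).isCompact)
      fun j => (isClopen_pow_dvd hπ j).isClosed.inter hV.isClosed_compl
    obtain ⟨x, hx⟩ := this
    simp only [Set.mem_iInter] at hx
    have hx0 := eq_zero_of_forall_pow_dvd hπ fun e => (hx e).1
    exact (hx 0).2 (hx0 ▸ h0)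
  · rintro ⟨j, -, hj⟩
    exact Filter.mem_of_superset ((isClopen_pow_dvd hπ j).isOpen.mem_nhds (by simp)) hj

omit hπ in
variable (R) in
-- Makes the Borel structure on finite powers agree with the product one, so that polynomial maps
-- are measurable for it.
theorem secondCountableTopology_of_isDiscreteValuationRing : SecondCountableTopology R := by
  obtain ⟨π, hπ⟩ := IsDiscreteValuationRing.exists_irreducible R
  let _ := IsTopologicalAddGroup.rightUniformSpace R
  have := isUniformAddGroup_of_addCommGroup (G := R)
  have : (nhds (0 : R)).IsCountablyGenerated :=
    (hasBasis_nhds_zero_pow_dvd hπ).isCountablyGenerated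
  have := IsUniformAddGroup.uniformity_countably_generated (α := R)
  exact UniformSpace.secondCountable_of_separable R

theorem isClopen_units (σ : Type*) [Finite σ] : IsClopen {u : σ → R | ∀ i, IsUnit (u i)} := by
  simp only [isUnit_iff_not_dvd hπ, Set.ofPred_forall]
  refine isClopen_iInter_of_finite fun i => ?_
  have := (isClopen_pow_dvd hπ 1).compl
  simp only [pow_one] at this
  exact this.preimage (continuous_apply i)

/-- Otherwise the nested closed sets of unit vectors whose gradient is divisible by `π^e` are all
nonempty, and by compactness some unit vector has zero gradient. -/
theorem exists_forall_not_pow_dvd_pderiv {σ : Type*} [Finite σ] (h : MvPolynomial σ R)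
    (hh : ∀ u : σ → R, (∀ i, IsUnit (u i)) →
      ∃ i, MvPolynomial.eval u (MvPolynomial.pderiv i h) ≠ 0) :
    ∃ e, ∀ u : σ → R, (∀ i, IsUnit (u i)) →
      ∃ i, ¬ π ^ e ∣ MvPolynomial.eval u (MvPolynomial.pderiv i h) := by
  by_contra! hcon
  have hcl : ∀ e, IsClosed ({u : σ → R | ∀ i, IsUnit (u i)} ∩
      {u | ∀ i, π ^ e ∣ MvPolynomial.eval u (MvPolynomial.pderiv i h)}) := fun e => by
    refine (isClopen_units hπ σ).isClosed.inter ?_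
    simp only [Set.ofPred_forall]
    exact isClosed_iInter fun i =>
      (isClopen_pow_dvd hπ e).isClosed.preimage (MvPolynomial.continuous_eval _)
  obtain ⟨u, hu⟩ := IsCompact.nonempty_iInter_of_sequence_nonempty_isCompact_isClosed
    (fun e => {u : σ → R | ∀ i, IsUnit (u i)} ∩
      {u | ∀ i, π ^ e ∣ MvPolynomial.eval u (MvPolynomial.pderiv i h)})
    (fun e => Set.inter_subset_inter_right _ fun u hu i =>
      (pow_dvd_pow π e.le_succ).trans (hu i))
    (fun e => (hcon e).imp fun u hu => hu) (hcl 0).isCompact hcl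
  simp only [Set.mem_iInter] at hu
  obtain ⟨i, hi⟩ := hh u (hu 0).1
  exact hi (eq_zero_of_forall_pow_dvd hπ fun e => (hu e).2 i)

end Compact

/-! ### Equidistribution of polynomial values on unit vectors -/

section Measure

variable {R : Type*} [CommRing R] [IsDomain R] [IsDiscreteValuationRing R] [TopologicalSpace R]
  [IsTopologicalRing R] [CompactSpace R] [T2Space R] {π : R} (hπ : Irreducible π)
include hπ

theorem finite_quotient_span_pow (j : ℕ) : Finite (R ⧸ Ideal.span {π ^ j}) :=
  AddSubgroup.quotient_finite_of_isOpen (Ideal.span {π ^ j}).toAddSubgroup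
    (IsDiscreteValuationRing.isOpen_iff.mpr (by simp [hπ.ne_zero]))

theorem finite_quotient_span : Finite (R ⧸ Ideal.span {π}) := by
  simpa using finite_quotient_span_pow hπ 1

theorem one_lt_card_quotient_span : 1 < Nat.card (R ⧸ Ideal.span {π}) := by
  have := finite_quotient_span hπ
  have : Nontrivial (R ⧸ Ideal.span {π}) := Ideal.Quotient.nontrivial_iff.mpr fun h =>
    hπ.not_isUnit (Ideal.span_singleton_eq_top.mp h)
  exact Finite.one_lt_card

omit hπ [IsDomain R] [IsDiscreteValuationRing R] [TopologicalSpace R]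
  [IsTopologicalRing R] [CompactSpace R] [T2Space R] in
theorem mk_eq_mk_iff_dvd {d x y : R} :
    (Ideal.Quotient.mk (Ideal.span {d}) x = Ideal.Quotient.mk (Ideal.span {d}) y) ↔ d ∣ x - y := by
  rw [Ideal.Quotient.mk_eq_mk_iff_sub_mem, Ideal.mem_span_singleton]

variable [MeasurableSpace R] [BorelSpace R]

theorem measurableSet_pow_dvd {Ω : Type*} [MeasurableSpace Ω] {F : Ω → R} (hF : Measurable F)
    (j : ℕ) : MeasurableSet {x | π ^ j ∣ F x} :=
  hF (isClopen_pow_dvd hπ j).isClosed.measurableSet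

/-- Write `F x = π^j y` and sort by the residue class of `y` modulo `π`. -/
theorem measureReal_pow_dvd_eq_sum {Ω : Type*} [MeasurableSpace Ω] (ν : Measure Ω)
    [IsFiniteMeasure ν] [Fintype (R ⧸ Ideal.span {π})] {F : Ω → R} (hF : Measurable F) (j : ℕ) :
    ν.real {x | π ^ j ∣ F x} =
      ∑ r : R ⧸ Ideal.span {π}, ν.real {x | π ^ (j + 1) ∣ F x - r.out * π ^ j} := by
  have hset : {x | π ^ j ∣ F x} =
      ⋃ r : R ⧸ Ideal.span {π}, {x | π ^ (j + 1) ∣ F x - r.out * π ^ j} := by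
    ext x
    simp only [Set.mem_ofPred_eq, Set.mem_iUnion]
    constructor
    · rintro ⟨y, hy⟩
      refine ⟨Ideal.Quotient.mk _ y, ?_⟩
      have h1 : π ∣ y - (Ideal.Quotient.mk (Ideal.span {π}) y).out :=
        mk_eq_mk_iff_dvd.mp (Ideal.Quotient.mk_out _).symm
      rw [hy, pow_succ, mul_comm _ (π ^ j), ← mul_sub]
      exact mul_dvd_mul_left _ h1
    · rintro ⟨r, hr⟩
      exact (dvd_sub_left (Dvd.intro_left _ rfl)).mp ((pow_dvd_pow π j.le_succ).trans hr)
  rw [hset, measureReal_iUnion_fintype]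
  · intro r r' hrr'
    refine Set.disjoint_left.mpr fun x hx hx' => hrr' ?_
    have h1 := dvd_sub hx' hx
    rw [show F x - r'.out * π ^ j - (F x - r.out * π ^ j) = π ^ j * (r.out - r'.out) by ring,
      pow_succ] at h1
    have h2 := mk_eq_mk_iff_dvd.mpr ((mul_dvd_mul_iff_left (pow_ne_zero j hπ.ne_zero)).mp h1)
    rwa [Ideal.Quotient.mk_out, Ideal.Quotient.mk_out] at h2
  · exact fun r => measurableSet_pow_dvd hπ (hF.sub_const _) _

theorem measureReal_setOf_pow_dvd (μ : Measure R) [IsProbabilityMeasure μ]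
    [μ.IsAddLeftInvariant] (j : ℕ) :
    μ.real {x | π ^ j ∣ x} = ((Nat.card (R ⧸ Ideal.span {π}) : ℝ)⁻¹) ^ j := by
  have := finite_quotient_span hπ
  have := Fintype.ofFinite (R ⧸ Ideal.span {π})
  have hq := one_lt_card_quotient_span hπ
  induction j with
  | zero => simp
  | succ j ih =>
    have h1 := measureReal_pow_dvd_eq_sum hπ μ (F := fun x => x) measurable_id j
    have h2 : ∀ r : R ⧸ Ideal.span {π}, μ.real {x | π ^ (j + 1) ∣ x - r.out * π ^ j} =
        μ.real {x | π ^ (j + 1) ∣ x} := fun r => by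
      rw [measureReal_def, measureReal_def,
        ← measure_preimage_add μ (-(r.out * π ^ j)) {x | π ^ (j + 1) ∣ x}]
      simp [Set.preimage, sub_eq_neg_add]
    simp only [h2, Finset.sum_const, Finset.card_univ, nsmul_eq_mul] at h1
    rw [ih, ← Nat.card_eq_fintype_card] at h1
    rw [eq_comm, pow_succ', h1, inv_mul_cancel_left₀]
    positivity

variable {σ : Type*} [Fintype σ]

/-- Reduction of the coordinates modulo `d`. -/
noncomputable def reduceMod (σ : Type*) (d : R) (x : σ → R) : σ → R ⧸ Ideal.span {d} :=
  fun i => Ideal.Quotient.mk _ (x i)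

omit hπ [IsDomain R] [IsDiscreteValuationRing R] [TopologicalSpace R]
  [IsTopologicalRing R] [CompactSpace R] [T2Space R] [MeasurableSpace R] [BorelSpace R]
  [Fintype σ] in
theorem reduceMod_preimage (d : R) (c : σ → R ⧸ Ideal.span {d}) :
    reduceMod σ d ⁻¹' {c} = {x | ∀ i, d ∣ x i - (c i).out} := by
  ext x
  simp only [Set.mem_preimage, Set.mem_singleton_iff, Set.mem_ofPred_eq, reduceMod, funext_iff]
  exact forall_congr' fun i => by rw [← mk_eq_mk_iff_dvd, Ideal.Quotient.mk_out]

theorem measurableSet_reduceMod (j : ℕ) (c : σ → R ⧸ Ideal.span {π ^ j}) :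
    MeasurableSet (reduceMod σ (π ^ j) ⁻¹' {c}) := by
  rw [reduceMod_preimage, Set.ofPred_forall]
  exact MeasurableSet.iInter fun i =>
    measurableSet_pow_dvd hπ ((measurable_pi_apply i).sub_const _) j

theorem measureReal_eq_sum_reduceMod (ν : Measure (σ → R)) [IsFiniteMeasure ν] (j : ℕ)
    [Fintype (σ → R ⧸ Ideal.span {π ^ j})] (S : Set (σ → R)) :
    ν.real S = ∑ c, ν.real (reduceMod σ (π ^ j) ⁻¹' {c} ∩ S) := by
  have h := sum_measureReal_preimage_singleton (μ := ν.restrict S) Finset.univ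
    (f := reduceMod σ (π ^ j)) fun c _ => measurableSet_reduceMod hπ j c
  simp only [Finset.coe_univ, Set.preimage_univ, measureReal_restrict_apply_univ] at h
  rw [← h]
  exact Finset.sum_congr rfl fun c _ =>
    measureReal_restrict_apply (measurableSet_reduceMod hπ j c)

omit hπ [IsDomain R] [IsDiscreteValuationRing R] [CompactSpace R] [T2Space R] in
omit [Fintype σ] in
theorem measureReal_preimage_add (ν : Measure (σ → R)) [ν.IsAddLeftInvariant]
    (v : σ → R) (S : Set (σ → R)) [SecondCountableTopology R] :
    ν.real ((fun x => v + x) ⁻¹' S) = ν.real S := by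
  rw [measureReal_def, measure_preimage_add, measureReal_def]

/-- Such a set is a union of cosets modulo `π^j`; these are finitely many and, by invariance, of
equal mass. -/
theorem exists_rat_measureReal [SecondCountableTopology R] (ν : Measure (σ → R))
    [IsProbabilityMeasure ν] [ν.IsAddLeftInvariant] (j : ℕ) (S : Set (σ → R))
    (hS : ∀ x y : σ → R, (∀ i, π ^ j ∣ x i - y i) → x ∈ S → y ∈ S) :
    ∃ t : ℚ, ν.real S = t := by
  classical
  have := finite_quotient_span_pow hπ j
  have := Fintype.ofFinite (σ → R ⧸ Ideal.span {π ^ j})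
  have hfib : ∀ c : σ → R ⧸ Ideal.span {π ^ j}, ν.real (reduceMod σ (π ^ j) ⁻¹' {c}) =
      ν.real {x | ∀ i, π ^ j ∣ x i} := fun c => by
    rw [← measureReal_preimage_add ν (-fun i => (c i).out) {x | ∀ i, π ^ j ∣ x i},
      reduceMod_preimage]
    simp [Set.preimage, sub_eq_neg_add]
  have h1 := measureReal_eq_sum_reduceMod hπ ν j Set.univ
  simp only [Set.inter_univ, hfib, probReal_univ, Finset.sum_const, nsmul_eq_mul] at h1
  have h2 : ∀ c : σ → R ⧸ Ideal.span {π ^ j}, ν.real (reduceMod σ (π ^ j) ⁻¹' {c} ∩ S) =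
      if (fun i => (c i).out) ∈ S then ν.real {x | ∀ i, π ^ j ∣ x i} else 0 := fun c => by
    rw [← hfib c]
    split_ifs with h
    · congr 1
      refine Set.inter_eq_left.mpr fun x hx => hS _ _ ?_ h
      rw [reduceMod_preimage] at hx
      exact fun i => (dvd_sub_comm).mp (hx i)
    · convert measureReal_empty (μ := ν)
      refine Set.eq_empty_of_forall_notMem fun x hx => h (hS _ _ ?_ hx.2)
      have := hx.1
      rw [reduceMod_preimage] at this
      exact this
  rw [measureReal_eq_sum_reduceMod hπ ν j S, Finset.sum_congr rfl fun c _ => h2 c,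
    Finset.sum_ite, Finset.sum_const, Finset.sum_const_zero, add_zero, nsmul_eq_mul,
    eq_inv_of_mul_eq_one_right h1.symm]
  exact ⟨((Finset.univ.filter fun c : σ → R ⧸ Ideal.span {π ^ j} =>
    (fun i => (c i).out) ∈ S).card : ℚ) *
      ((Finset.univ : Finset (σ → R ⧸ Ideal.span {π ^ j})).card : ℚ)⁻¹, by push_cast; rfl⟩

/-- On the units, a polynomial without critical points is equidistributed modulo high powers of
the uniformizer. -/
theorem exists_measureReal_pow_dvd_succ [SecondCountableTopology R] (ν : Measure (σ → R))
    [IsFiniteMeasure ν] [ν.IsAddLeftInvariant] (h : MvPolynomial σ R)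
    (hh : ∀ u : σ → R, (∀ i, IsUnit (u i)) →
      ∃ i, MvPolynomial.eval u (MvPolynomial.pderiv i h) ≠ 0) :
    ∃ N, ∀ z, ∀ j, N ≤ j →
      ν.real {u | (∀ i, IsUnit (u i)) ∧ π ^ j ∣ MvPolynomial.eval u h - z} =
        Nat.card (R ⧸ Ideal.span {π}) *
          ν.real {u | (∀ i, IsUnit (u i)) ∧ π ^ (j + 1) ∣ MvPolynomial.eval u h - z} := by
  classical
  obtain ⟨e, he⟩ := exists_forall_not_pow_dvd_pderiv hπ h hh
  have := finite_quotient_span hπ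
  have := Fintype.ofFinite (R ⧸ Ideal.span {π})
  have := finite_quotient_span_pow hπ (e + 1)
  have := Fintype.ofFinite (σ → R ⧸ Ideal.span {π ^ (e + 1)})
  -- For `j = 2e + 1 + k` the shift used below is a multiple of `π^(e+1+k)`. It preserves cosets
  -- modulo `π^(e+1)`, and its square is divisible by `π^(j+1)`.
  refine ⟨2 * e + 1, fun z j hj => ?_⟩
  set U := {u : σ → R | ∀ i, IsUnit (u i)} with hU
  have hinter : ∀ k, {u : σ → R | (∀ i, IsUnit (u i)) ∧ π ^ k ∣ MvPolynomial.eval u h - z} =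
    U ∩ {u | π ^ k ∣ MvPolynomial.eval u h - z} := fun k => rfl
  rw [hinter, hinter, measureReal_eq_sum_reduceMod hπ ν (e + 1),
    measureReal_eq_sum_reduceMod hπ ν (e + 1) (U ∩ {u | π ^ (j + 1) ∣ _}), Finset.mul_sum]
  refine Finset.sum_congr rfl fun c _ => ?_
  set C := reduceMod σ (π ^ (e + 1)) ⁻¹' {c} with hC
  have hmeas : Measurable fun u => MvPolynomial.eval u h - z :=
    (MvPolynomial.continuous_eval h).measurable.sub_const z
  by_cases hne : (C ∩ U).Nonempty
  · obtain ⟨u₀, hu₀C, hu₀⟩ := hne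
    have hCmem : ∀ u, u ∈ C ↔ ∀ i, π ^ (e + 1) ∣ u i - u₀ i := fun u => by
      have : reduceMod σ (π ^ (e + 1)) u₀ = c := hu₀C
      rw [hC, ← this]
      simp only [Set.mem_preimage, Set.mem_singleton_iff, funext_iff, reduceMod, mk_eq_mk_iff_dvd]
    have hCU : C ⊆ U := fun u hu i => by
      have h1 := (dvd_pow_self π e.succ_ne_zero).trans ((hCmem u).mp hu i)
      rw [isUnit_iff_not_dvd hπ, dvd_iff_dvd_of_dvd_sub h1, ← isUnit_iff_not_dvd hπ]
      exact hu₀ i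
    obtain ⟨i, hi⟩ := he u₀ hu₀
    obtain ⟨d, hd⟩ := dvd_pow_of_not_pow_dvd hπ hi
    -- Since `∂_i h(u₀) d = π^e`, moving coordinate `i` by `d r π^(e+1+k)` changes `h` by `r π^j`
    -- modulo `π^(j+1)` throughout the coset. Thus all residue classes at level `j + 1` have the
    -- same mass.
    have hshift : ∀ r : R, ν.real (C ∩ {u | π ^ (j + 1) ∣ MvPolynomial.eval u h - z - r * π ^ j}) =
        ν.real (C ∩ {u | π ^ (j + 1) ∣ MvPolynomial.eval u h - z}) := fun r => by
      obtain ⟨k, rfl⟩ := Nat.exists_eq_add_of_le hj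
      have hδ : π ^ (e + 1) ∣ d * r * π ^ (e + 1 + k) :=
        (pow_dvd_pow π (Nat.le_add_right _ _)).mul_left _
      rw [← measureReal_preimage_add ν (Pi.single i (d * r * π ^ (e + 1 + k)))]
      congr 1
      ext u
      simp only [Set.mem_preimage, Set.mem_inter_iff]
      have e1 : Pi.single i (d * r * π ^ (e + 1 + k)) + u ∈ C ↔ u ∈ C := by
        rw [hCmem, hCmem]
        refine forall_congr' fun i' => ?_
        rw [Pi.add_apply, add_sub_assoc]
        refine dvd_add_right ?_
        rcases eq_or_ne i' i with rfl | hii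
        · simpa using hδ
        · simp [Pi.single_eq_of_ne hii]
      rw [e1]
      refine and_congr_right fun hu => ?_
      rw [hCmem] at hu
      simp only [Set.mem_ofPred_eq]
      obtain ⟨c', hc'⟩ := exists_eval_add_single h i (d * r * π ^ (e + 1 + k)) u
      obtain ⟨y, hy⟩ := pow_dvd_eval_sub_eval (MvPolynomial.pderiv i h) hu
      refine dvd_iff_dvd_of_dvd_sub ⟨d * r * y + d ^ 2 * r ^ 2 * π ^ k * c', ?_⟩
      rw [hc', sub_eq_iff_eq_add.mp hy]
      linear_combination -(r * π ^ (e + 1 + k)) * hd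
    rw [← Set.inter_assoc, ← Set.inter_assoc, Set.inter_eq_left.mpr hCU]
    have h1 := measureReal_pow_dvd_eq_sum hπ (ν.restrict C) hmeas j
    rw [measureReal_restrict_apply (measurableSet_pow_dvd hπ hmeas j)] at h1
    simp only [measureReal_restrict_apply (measurableSet_pow_dvd hπ (hmeas.sub_const _) _)] at h1
    simp only [Set.inter_comm _ C, hshift, Finset.sum_const, Finset.card_univ, nsmul_eq_mul] at h1
    rw [h1, Nat.card_eq_fintype_card]
  · have : C ∩ U = ∅ := Set.not_nonempty_iff_eq_empty.mp hne
    rw [← Set.inter_assoc, ← Set.inter_assoc, this]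
    simp

/-- Up to level `N` the two sets coincide; beyond it, each further level divides both masses by `q`.
-/
theorem exists_measureReal_pow_dvd_eq [SecondCountableTopology R] (ν : Measure (σ → R))
    [IsFiniteMeasure ν] [ν.IsAddLeftInvariant] (h : MvPolynomial σ R)
    (hh : ∀ u : σ → R, (∀ i, IsUnit (u i)) →
      ∃ i, MvPolynomial.eval u (MvPolynomial.pderiv i h) ≠ 0) :
    ∃ N, ∀ z z', π ^ N ∣ z - z' → ∀ j,
      ν.real {u | (∀ i, IsUnit (u i)) ∧ π ^ j ∣ MvPolynomial.eval u h - z} =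
        ν.real {u | (∀ i, IsUnit (u i)) ∧ π ^ j ∣ MvPolynomial.eval u h - z'} := by
  obtain ⟨N, hN⟩ := exists_measureReal_pow_dvd_succ hπ ν h hh
  have hq := one_lt_card_quotient_span hπ
  refine ⟨N, fun z z' hz j => ?_⟩
  induction j with
  | zero => simp
  | succ j ih =>
    by_cases hj : N ≤ j
    · rw [hN z j hj, hN z' j hj] at ih
      exact mul_left_cancel₀ (by positivity) ih
    · congr 1
      ext u
      refine and_congr_right fun _ => dvd_iff_dvd_of_dvd_sub ?_
      rw [sub_sub_sub_cancel_left, dvd_sub_comm]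
      exact (pow_dvd_pow π (by omega)).trans hz

end Measure

/-! ### Haar measure under coordinatewise scaling -/

section Scaling

/-- The pullback of `ν` along `φ` is translation invariant and finite, so by uniqueness of Haar
measure it is a multiple of `ν`; evaluating on the whole group gives the constant. -/
theorem measure_image_of_isClosedEmbedding {G : Type*} [AddCommGroup G] [TopologicalSpace G]
    [IsTopologicalAddGroup G] [CompactSpace G] [MeasurableSpace G] [BorelSpace G]
    (ν : Measure G) [ν.IsAddHaarMeasure] [IsProbabilityMeasure ν] (φ : G →+ G)
    (hφ : Topology.IsClosedEmbedding φ) (S : Set G) :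
    ν (φ '' S) = ν (Set.range φ) * ν S := by
  have hm := hφ.measurableEmbedding
  have h1 : (ν.comap φ).IsAddLeftInvariant := by
    refine ⟨fun g => ?_⟩
    ext S hS
    rw [Measure.map_apply (measurable_const_add g) hS, hm.comap_apply, hm.comap_apply,
      ← measure_preimage_add ν (φ g) (φ '' S)]
    congr 1
    ext x
    constructor
    · rintro ⟨y, hy, rfl⟩
      exact ⟨g + y, hy, map_add _ _ _⟩
    · rintro ⟨y, hy, hyx⟩
      refine ⟨-g + y, by simpa using hy, ?_⟩
      rw [map_add, map_neg, hyx]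
      simp
  have h2 : IsFiniteMeasure (ν.comap φ) := ⟨by rw [hm.comap_apply]; exact measure_lt_top _ _⟩
  obtain ⟨c, h3⟩ : ∃ c : NNReal, ν.comap φ = c • ν :=
    ⟨_, Measure.isAddInvariant_eq_smul_of_compactSpace (ν.comap φ) ν⟩
  rw [← Set.image_univ, ← hm.comap_apply, ← hm.comap_apply, h3]
  rw [Measure.smul_apply, Measure.smul_apply, measure_univ, ENNReal.smul_def, ENNReal.smul_def,
    smul_eq_mul, smul_eq_mul, mul_one]

variable {R : Type*} [CommRing R] [IsDomain R] [IsDiscreteValuationRing R] [TopologicalSpace R]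
  [IsTopologicalRing R] [CompactSpace R] [T2Space R] {π : R} (hπ : Irreducible π)
  [MeasurableSpace R] [BorelSpace R] [SecondCountableTopology R] {σ : Type*} [Fintype σ]

/-- The map `x ↦ (π ^ κ_i x_i)_i`. -/
def scaleMap (π : R) (κ : σ → ℕ) : (σ → R) →+ (σ → R) where
  toFun x i := π ^ κ i * x i
  map_zero' := by ext; simp
  map_add' x y := by ext; simp [mul_add]

include hπ

omit [IsDiscreteValuationRing R] [MeasurableSpace R] [BorelSpace R]
  [SecondCountableTopology R] [Fintype σ] in
theorem isClosedEmbedding_scaleMap (κ : σ → ℕ) :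
    Topology.IsClosedEmbedding (scaleMap π κ : (σ → R) → σ → R) := by
  refine Continuous.isClosedEmbedding ?_ fun x y hxy => funext fun i => ?_
  · exact continuous_pi fun i => continuous_const.mul (continuous_apply i)
  · exact mul_left_cancel₀ (pow_ne_zero _ hπ.ne_zero) (congrFun hxy i)

theorem measureReal_image_scaleMap (μ : Measure R) [IsProbabilityMeasure μ] [μ.IsAddHaarMeasure]
    (κ : σ → ℕ) (S : Set (σ → R)) :
    (Measure.pi fun _ : σ => μ).real (scaleMap π κ '' S) =
      ((Nat.card (R ⧸ Ideal.span {π}) : ℝ)⁻¹) ^ (∑ i, κ i) *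
        (Measure.pi fun _ : σ => μ).real S := by
  rw [measureReal_def, measure_image_of_isClosedEmbedding _ _ (isClosedEmbedding_scaleMap hπ κ),
    ENNReal.toReal_mul, measureReal_def]
  congr 1
  have h1 : Set.range (scaleMap π κ : (σ → R) → σ → R) =
      Set.univ.pi fun i => {x | π ^ κ i ∣ x} := by
    ext x
    simp only [Set.mem_range, Set.mem_pi, Set.mem_univ, true_imp_iff, Set.mem_ofPred_eq]
    constructor
    · rintro ⟨y, rfl⟩ i
      exact ⟨y i, rfl⟩
    · intro h
      choose y hy using h
      exact ⟨y, funext fun i => (hy i).symm⟩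
  rw [h1, Measure.pi_pi, ENNReal.toReal_prod, ← Finset.prod_pow_eq_pow_sum]
  exact Finset.prod_congr rfl fun i _ => measureReal_setOf_pow_dvd hπ μ _

end Scaling

/-! ### Comparison of measures by slices -/

section Slices

variable {X : Type*} [MeasurableSpace X] (μ : Measure X) [IsProbabilityMeasure μ]
  {σ ρ : Type*} [Fintype σ] [Fintype ρ]

/-- Fubini, used to freeze `y`: then `π^B G(y)` is a constant and only the gradient of `F` matters.
-/
theorem measureReal_pi_sum_eq_mul_of_slice_left {S S' : Set (σ ⊕ ρ → X)} (hS : MeasurableSet S)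
    (hS' : MeasurableSet S') (c : ℕ)
    (h : ∀ y : ρ → X, (Measure.pi fun _ : σ => μ).real {x | Sum.elim x y ∈ S} =
      c * (Measure.pi fun _ : σ => μ).real {x | Sum.elim x y ∈ S'}) :
    (Measure.pi fun _ : σ ⊕ ρ => μ).real S = c * (Measure.pi fun _ : σ ⊕ ρ => μ).real S' := by
  have key : ∀ S : Set (σ ⊕ ρ → X), MeasurableSet S → (Measure.pi fun _ : σ ⊕ ρ => μ) S =
      ∫⁻ y, (Measure.pi fun _ : σ => μ) {x | Sum.elim x y ∈ S} ∂(Measure.pi fun _ : ρ => μ) := by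
    intro S hS
    have hp := measurePreserving_sumPiEquivProdPi_symm (X := fun _ : σ ⊕ ρ => X) fun _ => μ
    rw [← hp.measure_preimage hS.nullMeasurableSet, Measure.prod_apply_symm (hp.measurable hS)]
    refine lintegral_congr fun y => congrArg _ ?_
    ext x
    simp only [Set.mem_preimage, Set.mem_ofPred_eq]
    rw [iff_iff_eq]
    congr 1
  have h1 : ∀ y : ρ → X, (Measure.pi fun _ : σ => μ) {x | Sum.elim x y ∈ S} =
      c * (Measure.pi fun _ : σ => μ) {x | Sum.elim x y ∈ S'} := fun y => by
    have := h y
    rwa [measureReal_def, measureReal_def, ← ENNReal.toReal_natCast, ← ENNReal.toReal_mul,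
      ENNReal.toReal_eq_toReal_iff' (by finiteness) (by finiteness)] at this
  rw [measureReal_def, measureReal_def, ← ENNReal.toReal_natCast c, ← ENNReal.toReal_mul,
    key S hS, key S' hS', ← lintegral_const_mul' _ _ (by finiteness)]
  simp only [h1]

theorem measureReal_pi_sum_eq_of_slice_right {S S' : Set (σ ⊕ ρ → X)} (hS : MeasurableSet S)
    (hS' : MeasurableSet S')
    (h : ∀ x : σ → X, (Measure.pi fun _ : ρ => μ).real {y | Sum.elim x y ∈ S} =
      (Measure.pi fun _ : ρ => μ).real {y | Sum.elim x y ∈ S'}) :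
    (Measure.pi fun _ : σ ⊕ ρ => μ).real S = (Measure.pi fun _ : σ ⊕ ρ => μ).real S' := by
  have key : ∀ S : Set (σ ⊕ ρ → X), MeasurableSet S → (Measure.pi fun _ : σ ⊕ ρ => μ) S =
      ∫⁻ x, (Measure.pi fun _ : ρ => μ) {y | Sum.elim x y ∈ S} ∂(Measure.pi fun _ : σ => μ) := by
    intro S hS
    have hp := measurePreserving_sumPiEquivProdPi_symm (X := fun _ : σ ⊕ ρ => X) fun _ => μ
    rw [← hp.measure_preimage hS.nullMeasurableSet, Measure.prod_apply (hp.measurable hS)]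
    refine lintegral_congr fun y => congrArg _ ?_
    ext x
    simp only [Set.mem_preimage, Set.mem_ofPred_eq]
    rw [iff_iff_eq]
    congr 1
  have h1 : ∀ x : σ → X, (Measure.pi fun _ : ρ => μ) {y | Sum.elim x y ∈ S} =
      (Measure.pi fun _ : ρ => μ) {y | Sum.elim x y ∈ S'} := fun y => by
    have := h y
    rwa [measureReal_def, measureReal_def,
      ENNReal.toReal_eq_toReal_iff' (by finiteness) (by finiteness)] at this
  rw [measureReal_def, measureReal_def, key S hS, key S' hS']
  simp only [h1]

end Slices

/-! ### Level sets of `π^A F + π^B G` on unit vectors -/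

section Levels

variable {R : Type*} [CommRing R] [IsDomain R] [IsDiscreteValuationRing R] [TopologicalSpace R]
  [IsTopologicalRing R] [CompactSpace R] [T2Space R] {π : R} (hπ : Irreducible π)
  [MeasurableSpace R] [BorelSpace R] [SecondCountableTopology R]
  {σ ρ : Type*} [Fintype σ] [Fintype ρ]
  (μ : Measure R) [IsProbabilityMeasure μ] [μ.IsAddHaarMeasure]
  (F : MvPolynomial σ R) (G : MvPolynomial ρ R)

/-- The unit vectors at which `π ^ A F + π ^ B G` is divisible by `π ^ j`. -/
def levelSet (π : R) (F : MvPolynomial σ R) (G : MvPolynomial ρ R) (j A B : ℕ) :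
    Set (σ ⊕ ρ → R) :=
  {x | (∀ i, IsUnit (x i)) ∧ π ^ j ∣ π ^ A * MvPolynomial.eval (x ∘ Sum.inl) F +
    π ^ B * MvPolynomial.eval (x ∘ Sum.inr) G}

include hπ

theorem measurableSet_levelSet (j A B : ℕ) : MeasurableSet (levelSet π F G j A B) := by
  refine (isClopen_units hπ (σ ⊕ ρ)).isClosed.measurableSet.inter
    (measurableSet_pow_dvd hπ (Continuous.measurable ?_) j)
  have h1 : Continuous fun x : σ ⊕ ρ → R => MvPolynomial.eval (x ∘ Sum.inl) F :=
    (MvPolynomial.continuous_eval F).comp (by fun_prop)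
  have h2 : Continuous fun x : σ ⊕ ρ → R => MvPolynomial.eval (x ∘ Sum.inr) G :=
    (MvPolynomial.continuous_eval G).comp (by fun_prop)
  fun_prop

theorem exists_rat_levelSet (j A B : ℕ) :
    ∃ t : ℚ, (Measure.pi fun _ : σ ⊕ ρ => μ).real (levelSet π F G j A B) = t := by
  -- The modulus is `π^(j+1)` rather than `π^j` so that being a unit is still detected when `j = 0`.
  refine exists_rat_measureReal hπ _ (j + 1) _ fun x y hxy ⟨hx, hj⟩ => ⟨fun i => ?_, ?_⟩
  · have h1 := (dvd_pow_self π j.succ_ne_zero).trans (hxy i)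
    rw [isUnit_iff_not_dvd hπ, ← dvd_iff_dvd_of_dvd_sub h1, ← isUnit_iff_not_dvd hπ]
    exact hx i
  · have h1 : ∀ i, π ^ j ∣ x i - y i := fun i => (pow_dvd_pow π j.le_succ).trans (hxy i)
    have h2 := pow_dvd_eval_sub_eval F (x := x ∘ Sum.inl) (y := y ∘ Sum.inl) fun i => h1 _
    have h3 := pow_dvd_eval_sub_eval G (x := x ∘ Sum.inr) (y := y ∘ Sum.inr) fun i => h1 _
    refine (dvd_iff_dvd_of_dvd_sub ?_).mp hj
    convert dvd_add (h2.mul_left (π ^ A)) (h3.mul_left (π ^ B)) using 1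
    ring

omit [TopologicalSpace R] [IsTopologicalRing R] [CompactSpace R] [T2Space R] [IsDiscreteValuationRing R]
  [MeasurableSpace R] [BorelSpace R] [SecondCountableTopology R] [Fintype σ] [Fintype ρ] in
theorem levelSet_succ (j A B : ℕ) :
    levelSet π F G (j + 1) (A + 1) (B + 1) = levelSet π F G j A B := by
  ext x
  refine and_congr_right fun _ => ?_
  rw [← mul_dvd_mul_iff_left (b := π ^ j) hπ.ne_zero, ← pow_succ']
  ring_nf

/-- Multiplying by `π^A` keeps the gradient of `F` nonzero, so equidistribution applies to `π^A F`.
Its threshold is uniform in the target value, hence in the frozen `y`. -/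
theorem exists_levelSet_geometric
    (hF : ∀ u : σ → R, (∀ i, IsUnit (u i)) →
      ∃ i, MvPolynomial.eval u (MvPolynomial.pderiv i F) ≠ 0) (A B : ℕ) :
    ∃ N, ∀ j, N ≤ j → (Measure.pi fun _ : σ ⊕ ρ => μ).real (levelSet π F G j A B) =
      Nat.card (R ⧸ Ideal.span {π}) *
        (Measure.pi fun _ : σ ⊕ ρ => μ).real (levelSet π F G (j + 1) A B) := by
  obtain ⟨N, hN⟩ := exists_measureReal_pow_dvd_succ hπ (Measure.pi fun _ : σ => μ)
    (MvPolynomial.C (π ^ A) * F) fun u hu => by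
      obtain ⟨i, hi⟩ := hF u hu
      exact ⟨i, by
        simpa [Derivation.leibniz, MvPolynomial.pderiv_C] using ⟨fun h => absurd h hπ.ne_zero, hi⟩⟩
  refine ⟨N, fun j hj => measureReal_pi_sum_eq_mul_of_slice_left μ
    (measurableSet_levelSet hπ F G _ _ _) (measurableSet_levelSet hπ F G _ _ _) _ fun y => ?_⟩
  by_cases hy : ∀ i, IsUnit (y i)
  · convert hN (-(π ^ B * MvPolynomial.eval y G)) j hj using 3
    all_goals simp [levelSet, hy, Sum.forall]
  · simp [levelSet, hy, Sum.forall]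

/-- For `d ≥ N` the targets `-π^d G(y)` and `-π^N G(y)` agree modulo `π^N`, and `F` takes values
near either with equal mass at every level. -/
theorem exists_levelSet_right
    (hF : ∀ u : σ → R, (∀ i, IsUnit (u i)) →
      ∃ i, MvPolynomial.eval u (MvPolynomial.pderiv i F) ≠ 0) :
    ∃ N, ∀ d, N ≤ d → ∀ j, (Measure.pi fun _ : σ ⊕ ρ => μ).real (levelSet π F G j 0 d) =
        (Measure.pi fun _ : σ ⊕ ρ => μ).real (levelSet π F G j 0 N) := by
  obtain ⟨N, hN⟩ := exists_measureReal_pow_dvd_eq hπ (Measure.pi fun _ : σ => μ) F hF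
  refine ⟨N, fun d hd j => ?_⟩
  rw [← one_mul ((Measure.pi _).real (levelSet π F G j 0 N)), ← Nat.cast_one]
  refine measureReal_pi_sum_eq_mul_of_slice_left μ
    (measurableSet_levelSet hπ F G _ _ _) (measurableSet_levelSet hπ F G _ _ _) _ fun y => ?_
  by_cases hy : ∀ i, IsUnit (y i)
  · have := hN (-(π ^ d * MvPolynomial.eval y G)) (-(π ^ N * MvPolynomial.eval y G))
      (dvd_sub (dvd_neg.mpr ((pow_dvd_pow π hd).mul_right _)) (dvd_neg.mpr (Dvd.intro _ rfl))) j
    rw [Nat.cast_one, one_mul]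
    convert this using 3
    all_goals simp [levelSet, hy, Sum.forall]
  · simp [levelSet, hy, Sum.forall]

theorem exists_levelSet_left
    (hG : ∀ u : ρ → R, (∀ i, IsUnit (u i)) →
      ∃ i, MvPolynomial.eval u (MvPolynomial.pderiv i G) ≠ 0) :
    ∃ N, ∀ d, N ≤ d → ∀ j, (Measure.pi fun _ : σ ⊕ ρ => μ).real (levelSet π F G j d 0) =
        (Measure.pi fun _ : σ ⊕ ρ => μ).real (levelSet π F G j N 0) := by
  obtain ⟨N, hN⟩ := exists_measureReal_pow_dvd_eq hπ (Measure.pi fun _ : ρ => μ) G hG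
  refine ⟨N, fun d hd j => measureReal_pi_sum_eq_of_slice_right μ
    (measurableSet_levelSet hπ F G _ _ _) (measurableSet_levelSet hπ F G _ _ _) fun x => ?_⟩
  by_cases hx : ∀ i, IsUnit (x i)
  · have := hN (-(π ^ d * MvPolynomial.eval x F)) (-(π ^ N * MvPolynomial.eval x F))
      (dvd_sub (dvd_neg.mpr ((pow_dvd_pow π hd).mul_right _)) (dvd_neg.mpr (Dvd.intro _ rfl))) j
    convert this using 3
    all_goals simp [levelSet, hx, Sum.forall, add_comm]
  · simp [levelSet, hx, Sum.forall]

end Levels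

/-! ### From level masses to polynomial weights -/

section GeneratingWeight

theorem exists_isWeight_of_levels {q : ℕ} (hq : 1 < q) (V : ℕ → ℕ → ℕ → ℚ)
    (h0 : ∀ A B A' B', V 0 A B = V 0 A' B')
    (hdiag : ∀ j A B, V (j + 1) (A + 1) (B + 1) = V j A B)
    (hgeom : ∀ A B, ∃ N, ∀ j, N ≤ j → V j A B = q * V (j + 1) A B)
    (hright : ∃ N, ∀ d, N ≤ d → ∀ j, V j 0 d = V j 0 N)
    (hleft : ∃ N, ∀ d, N ≤ d → ∀ j, V j d 0 = V j N 0) :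
    ∃ w : ℕ → ℕ → ℚ[X], IsWeight w ∧ ∀ A B, ∀ T : ℂ, ‖T‖ < 1 →
      (1 - (q : ℂ)⁻¹ * T) * ∑' j, T ^ j * ((V j A B - V (j + 1) A B : ℚ) : ℂ) =
        Polynomial.aeval T (w A B) := by
  have hq0 : (q : ℚ) ≠ 0 := by positivity
  let b : ℕ → ℕ → ℕ → ℚ := fun A B j => V j A B - V (j + 1) A B
  -- These are the coefficients of `(1 - q⁻¹T) ∑ b_j T^j`. They vanish once the `b_j` decay
  -- geometrically with ratio `q⁻¹`, so the product is a polynomial.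
  let c : ℕ → ℕ → ℕ → ℚ := fun A B j => Nat.casesOn j (b A B 0) fun j => b A B (j + 1) - b A B j / q
  have hb : ∀ A B, ∃ N, ∀ j, N ≤ j → b A B (j + 1) = b A B j / q := fun A B => by
    obtain ⟨N, hN⟩ := hgeom A B
    refine ⟨N, fun j hj => ?_⟩
    have e1 := hN j hj
    have e2 := hN (j + 1) (by omega)
    simp only [b]
    rw [eq_div_iff hq0]
    linear_combination e2 - e1
  choose N hN using hb
  have hc : ∀ A B j, N A B + 1 ≤ j → c A B j = 0 := fun A B j hj => by
    obtain ⟨i, rfl⟩ : ∃ i, j = i + 1 := ⟨j - 1, by omega⟩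
    simp only [c]
    rw [hN A B i (by omega), sub_self]
  let w : ℕ → ℕ → ℚ[X] := fun A B =>
    ∑ j ∈ Finset.range (N A B + 1), Polynomial.monomial j (c A B j)
  have hw : ∀ A B j, (w A B).coeff j = c A B j := fun A B j => by
    simp only [w, Polynomial.finsetSum_coeff, Polynomial.coeff_monomial, Finset.sum_ite_eq',
      Finset.mem_range]
    split_ifs with h
    · rfl
    · exact (hc A B j (by omega)).symm
  refine ⟨w, ⟨fun A B => ?_, ?_, ?_⟩, fun A B T hT => ?_⟩
  · ext j
    rw [hw]
    rcases j with _ | _ | j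
    -- The constant coefficient at `(A+1, B+1)` is zero because levels `0` and `1` have equal mass
    -- there, both values being divisible by `π`.
    · simp [c, b, hdiag, h0 (A + 1) (B + 1) A B]
    · simp [hw, c, b, hdiag, h0 (A + 1) (B + 1) A B]
    · simp [hw, c, b, hdiag]
  · obtain ⟨D, hD⟩ := hleft
    refine ⟨D, fun d hd => ?_⟩
    ext j
    rw [hw, hw]
    simp only [c, b, hD d hd]
  · obtain ⟨D, hD⟩ := hright
    refine ⟨D, fun d hd => ?_⟩
    ext j
    rw [hw, hw]
    simp only [c, b, hD d hd]
  · have hρ : ‖(q : ℂ)⁻¹ * T‖ < 1 := by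
      rw [norm_mul, norm_inv, Complex.norm_natCast]
      have : (1 : ℝ) < q := by exact_mod_cast hq
      exact mul_lt_one_of_nonneg_of_lt_one_left (by positivity) (inv_lt_one_of_one_lt₀ this) hT.le
    have hgeo : ∀ k, b A B (k + N A B) = b A B (N A B) * ((q : ℚ)⁻¹) ^ k := fun k => by
      induction k with
      | zero => simp
      | succ k ih =>
        rw [show k + 1 + N A B = k + N A B + 1 by ring, hN A B _ (by omega), ih, pow_succ]
        ring
    have hs : Summable fun j => T ^ j * ((b A B j : ℚ) : ℂ) := by
      rw [← summable_nat_add_iff (N A B)]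
      refine ((summable_geometric_of_norm_lt_one hρ).mul_left
        (T ^ N A B * (b A B (N A B) : ℂ))).congr fun k => ?_
      rw [hgeo k]
      push_cast
      ring
    have hsum : Polynomial.aeval T (w A B) = ∑' j : ℕ, T ^ j * (Rat.cast (c A B j) : ℂ) := by
      rw [tsum_eq_sum (s := Finset.range (N A B + 1)) fun j hj => by
        rw [hc A B j (by simpa using hj)]; simp]
      simp only [w, map_sum, Polynomial.aeval_monomial]
      exact Finset.sum_congr rfl fun j _ => by simp [mul_comm]
    have hs1 : Summable fun j => T ^ (j + 1) * ((b A B (j + 1) : ℚ) : ℂ) :=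
      (summable_nat_add_iff 1).mpr hs
    have hs2 : Summable fun j => T ^ j * (Rat.cast (c A B j) : ℂ) :=
      summable_of_ne_finset_zero (s := Finset.range (N A B + 1)) fun j hj => by
        rw [hc A B j (by simpa using hj)]; simp
    have e1 : ∀ j, T ^ (j + 1) * (Rat.cast (c A B (j + 1)) : ℂ) = T ^ (j + 1) * ((b A B (j + 1) : ℚ) : ℂ)
        - ((q : ℂ)⁻¹ * T) * (T ^ j * ((b A B j : ℚ) : ℂ)) := fun j => by
      simp only [c]
      push_cast
      ring
    rw [hsum, hs2.tsum_eq_zero_add]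
    simp only [e1]
    rw [hs1.tsum_sub (hs.mul_left _), tsum_mul_left, sub_mul, one_mul]
    change _ = T ^ 0 * ((b A B 0 : ℚ) : ℂ) + _
    rw [← add_sub_assoc, ← hs.tsum_eq_zero_add]

end GeneratingWeight

/-! ### Newton polyhedra and quasi-homogeneity of face polynomials -/

section Newton

variable {σ : Type*} [Fintype σ] {R : Type*} [CommRing R] {f : MvPolynomial σ R}

omit [Fintype σ] in
theorem nonneg_of_mem_newtonPolyhedron {x : σ → ℝ} (hx : x ∈ newtonPolyhedron f) (i : σ) :
    0 ≤ x i := by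
  have h : newtonPolyhedron f ⊆ {x | 0 ≤ x i} := by
    refine convexHull_min ?_ (convex_halfSpace_ge (f := fun x : σ → ℝ => x i)
      ⟨fun _ _ => rfl, fun _ _ => rfl⟩ 0)
    rintro y ⟨ω, -, hy⟩
    exact (Nat.cast_nonneg _).trans (hy i)
  exact h hx

theorem dotProduct_le_of_mem_faceCone {τ : Set (σ → ℝ)} {a x y : σ → ℝ}
    (ha : a ∈ faceCone f τ) (hx : x ∈ τ) (hy : y ∈ newtonPolyhedron f) :
    a ⬝ᵥ x ≤ a ⬝ᵥ y := by
  obtain ⟨ha0, rfl⟩ := ha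
  rw [hx.2]
  refine csInf_le ⟨0, ?_⟩ ⟨y, hy, rfl⟩
  rintro _ ⟨z, hz, rfl⟩
  exact Finset.sum_nonneg fun i _ => mul_nonneg (ha0 i) (nonneg_of_mem_newtonPolyhedron hz i)

/-- For fixed `x` in the face, the inequalities `a ⬝ᵥ x ≤ a ⬝ᵥ y` are closed conditions on `a`, so
minimality at `x` passes from the cone to its closure. -/
theorem minDot_eq_of_mem_closure_faceCone {τ : Set (σ → ℝ)} {a x : σ → ℝ}
    (ha : a ∈ closure (faceCone f τ)) (hx : x ∈ τ) : minDot f a = a ⬝ᵥ x := by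
  have h1 : x ∈ newtonPolyhedron f := by
    obtain ⟨a', -, rfl⟩ := closure_nonempty_iff.mp ⟨a, ha⟩
    exact hx.1
  have h2 : closure (faceCone f τ) ⊆ {a | ∀ y ∈ newtonPolyhedron f, a ⬝ᵥ x ≤ a ⬝ᵥ y} := by
    refine closure_minimal (fun a ha y hy => dotProduct_le_of_mem_faceCone ha hx hy) ?_
    simp only [Set.ofPred_forall]
    refine isClosed_iInter fun y => isClosed_iInter fun _ => isClosed_le ?_ ?_ <;>
    exact continuous_finsetSum _ fun i _ => (continuous_apply i).mul continuous_const
  refine IsLeast.csInf_eq ⟨⟨x, h1, rfl⟩, ?_⟩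
  rintro _ ⟨y, hy, rfl⟩
  exact h2 ha y hy

theorem minDotNat_eq_sum {τ : Set (σ → ℝ)} {a : σ → ℕ} {ω : σ → ℕ}
    (ha : toReal a ∈ closure (faceCone f τ)) (hω : toReal ω ∈ τ) :
    minDotNat f a = ∑ i, a i * ω i := by
  rw [minDotNat, minDot_eq_of_mem_closure_faceCone ha hω]
  have : toReal a ⬝ᵥ toReal ω = ((∑ i, a i * ω i : ℕ) : ℝ) := by simp [dotProduct, toReal]
  rw [this, Nat.floor_natCast]

theorem eval_scale_facePoly {τ : Set (σ → ℝ)} (π : R) (κ : σ → ℕ) (A : ℕ)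
    (hκ : ∀ ω : σ →₀ ℕ, toReal ω ∈ τ → ∑ i, κ i * ω i = A) (x : σ → R) :
    MvPolynomial.eval (fun i => π ^ κ i * x i) (facePoly f τ) =
      π ^ A * MvPolynomial.eval x (facePoly f τ) := by
  classical
  simp only [facePoly, map_sum, MvPolynomial.eval_monomial, Finset.mul_sum]
  refine Finset.sum_congr rfl fun ω hω => ?_
  rw [← hκ ω (Finset.mem_filter.mp hω).2, Finsupp.prod_fintype _ _ fun _ => pow_zero _,
    Finsupp.prod_fintype _ _ fun _ => pow_zero _, ← Finset.prod_pow_eq_pow_sum]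
  simp only [mul_pow, ← pow_mul, Finset.prod_mul_distrib]
  ring

omit [Fintype σ] in
theorem toReal_mem_latticeCone {u : ℕ} (a : Fin u → σ → ℕ) (i : Fin u) :
    toReal (a i) ∈ latticeCone a :=
  ⟨Pi.single i 1, by simp [Pi.single_apply]⟩

/-- The combination `∑ k_i a_i`. -/
def comb {u : ℕ} (a : Fin u → σ → ℕ) (k : Fin u → ℕ) : σ → ℕ := fun j => ∑ i, k i * a i j

omit [Fintype σ] in
theorem toReal_comb {u : ℕ} (a : Fin u → σ → ℕ) (k : Fin u → ℕ) :
    toReal (comb a k) = ∑ i, k i • toReal (a i) := by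
  ext j
  simp [toReal, comb]

omit [Fintype σ] in
theorem comb_injective {u : ℕ} {a : Fin u → σ → ℕ}
    (ha : LinearIndependent ℝ fun i => toReal (a i)) : Function.Injective (comb a) := by
  intro k l h
  have h1 := congrArg toReal h
  rw [toReal_comb, toReal_comb] at h1
  have h2 := Fintype.linearIndependent_iff.mp ha (fun i => (k i : ℝ) - l i) (by
    simp only [sub_smul, Finset.sum_sub_distrib, Nat.cast_smul_eq_nsmul, h1, sub_self])
  funext i
  have := h2 i
  rw [sub_eq_zero] at this
  exact_mod_cast this

theorem sum_comb {u : ℕ} (a : Fin u → σ → ℕ) (k : Fin u → ℕ) :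
    ∑ j, comb a k j = ∑ i, k i * ∑ j, a i j := by
  simp only [comb, Finset.mul_sum]
  exact Finset.sum_comm

theorem eval_scale_comb_facePoly {τ : Set (σ → ℝ)} {u : ℕ} {a : Fin u → σ → ℕ}
    (ha : latticeCone a ⊆ closure (faceCone f τ)) (π : R) (k : Fin u → ℕ) (x : σ → R) :
    MvPolynomial.eval (fun i => π ^ comb a k i * x i) (facePoly f τ) =
      π ^ (∑ i, k i * minDotNat f (a i)) * MvPolynomial.eval x (facePoly f τ) := by
  refine eval_scale_facePoly π _ _ (fun ω hω => ?_) x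
  simp only [comb, Finset.sum_mul, minDotNat_eq_sum (ha (toReal_mem_latticeCone a _)) hω,
    Finset.mul_sum]
  rw [Finset.sum_comm]
  simp only [mul_assoc]

theorem sum_pos_of_linearIndependent {u : ℕ} {a : Fin u → σ → ℕ}
    (ha : LinearIndependent ℝ fun i => toReal (a i)) (i : Fin u) : 0 < ∑ j, a i j := by
  rw [Nat.pos_iff_ne_zero]
  intro h
  refine ha.ne_zero i (funext fun j => ?_)
  simpa [toReal] using (Finset.sum_eq_zero_iff.mp h) j (Finset.mem_univ j)

end Newton

/-! ### Orders and absolute values in a local field -/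

section Local

variable {K : Type*} [Field K] [ValuativeRel K] [TopologicalSpace K]
  [IsNonarchimedeanLocalField K]

omit [TopologicalSpace K] [IsNonarchimedeanLocalField K] in
theorem NewtonNonCritical.exists_eval_pderiv_ne_zero {σ : Type*} [Fintype σ]
    {f : MvPolynomial σ 𝒪[K]} (hf : NewtonNonCritical f) {τ : Set (σ → ℝ)}
    (hτ : IsFace (newtonPolyhedron f) τ) (u : σ → 𝒪[K]) (hu : ∀ i, IsUnit (u i)) :
    ∃ i, MvPolynomial.eval u (MvPolynomial.pderiv i (facePoly f τ)) ≠ 0 := by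
  by_contra! h
  refine hf τ hτ ⟨fun i => algebraMap 𝒪[K] K (u i), fun i => ?_, fun i => ?_⟩
  · exact (map_ne_zero_iff _ (FaithfulSMul.algebraMap_injective 𝒪[K] K)).mpr (hu i).ne_zero
  · have h1 := MvPolynomial.aeval_algebraMap_apply K u (MvPolynomial.pderiv i (facePoly f τ))
    rw [MvPolynomial.aeval_eq_eval, h i, map_zero] at h1
    exact h1

theorem resCard_eq {π : 𝒪[K]} (hπ : Irreducible π) :
    resCard K = Nat.card (𝒪[K] ⧸ Ideal.span {π}) := by
  rw [← hπ.maximalIdeal_eq]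
  rfl

variable (K) in
theorem t2Space_of_isNonarchimedeanLocalField : T2Space K := by
  let _ := IsTopologicalAddGroup.rightUniformSpace K
  have := isUniformAddGroup_of_addCommGroup (G := K)
  infer_instance

instance : T2Space 𝒪[K] :=
  have := t2Space_of_isNonarchimedeanLocalField K
  inferInstance

instance : SecondCountableTopology 𝒪[K] :=
  secondCountableTopology_of_isDiscreteValuationRing 𝒪[K]

theorem ord_eq_coe_iff {π : 𝒪[K]} (hπ : Irreducible π) {x : 𝒪[K]} {k : ℕ} :
    ord x = k ↔ π ^ k ∣ x ∧ ¬ π ^ (k + 1) ∣ x := by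
  have h1 : ∀ j : ℕ, (j : ℕ∞) ≤ ord x ↔ π ^ j ∣ x := fun j => by
    have h2 : ord (π ^ j) = j := by
      rw [ord, AddValuation.map_pow, IsDiscreteValuationRing.addVal_uniformizer hπ]
      simp
    rw [← h2]
    exact IsDiscreteValuationRing.addVal_le_iff_dvd
  rw [← h1, ← h1, not_le, Nat.cast_add, Nat.cast_one, Order.lt_add_one_iff_of_not_isMax (by simp)]
  exact ⟨fun h => ⟨h.ge, h.le⟩, fun h => le_antisymm h.2 h.1⟩

theorem pow_dvd_and_not_iff {π : 𝒪[K]} (hπ : Irreducible π) {x : 𝒪[K]} {k : ℕ} :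
    (π ^ k ∣ x ∧ ¬ π ^ (k + 1) ∣ x) ↔ ∃ u, IsUnit u ∧ π ^ k * u = x := by
  constructor
  · rintro ⟨⟨u, rfl⟩, h⟩
    refine ⟨u, ?_, rfl⟩
    rwa [pow_succ, mul_dvd_mul_iff_left (pow_ne_zero _ hπ.ne_zero), ← isUnit_iff_not_dvd hπ] at h
  · rintro ⟨u, hu, rfl⟩
    refine ⟨Dvd.intro _ rfl, ?_⟩
    rwa [pow_succ, mul_dvd_mul_iff_left (pow_ne_zero _ hπ.ne_zero), ← isUnit_iff_not_dvd hπ]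

theorem absO_of_ord_eq {x : 𝒪[K]} {k : ℕ} (h : ord x = k) :
    absO x = ((resCard K : ℝ)⁻¹) ^ k := by
  have hx : x ≠ 0 := by rintro rfl; simp [ord] at h
  rw [absO, if_neg hx, h, ENat.toNat_natCast, inv_pow]

end Local

section Local

variable {K : Type*} [Field K] [ValuativeRel K] [TopologicalSpace K]
  [IsNonarchimedeanLocalField K]

theorem one_lt_resCard : 1 < resCard K := by
  obtain ⟨π, hπ⟩ := IsDiscreteValuationRing.exists_irreducible 𝒪[K]
  rw [resCard_eq hπ]
  exact one_lt_card_quotient_span hπ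

theorem absO_nonneg (x : 𝒪[K]) : 0 ≤ absO x := by
  unfold absO
  split_ifs <;> positivity

theorem absO_le_one (x : 𝒪[K]) : absO x ≤ 1 := by
  unfold absO
  split_ifs
  · exact zero_le_one
  · have : (1 : ℝ) ≤ resCard K := by exact_mod_cast (one_lt_resCard (K := K)).le
    exact inv_le_one_of_one_le₀ (one_le_pow₀ this)

theorem norm_absO_cpow_le_one (x : 𝒪[K]) {s : ℂ} (hs : 0 < s.re) :
    ‖(absO x : ℂ) ^ s‖ ≤ 1 := by
  rcases (absO_nonneg x).eq_or_lt with h | h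
  · rw [← h, Complex.ofReal_zero, Complex.zero_cpow (by rintro rfl; simp at hs)]
    simp
  · rw [Complex.norm_cpow_eq_rpow_re_of_pos h]
    exact Real.rpow_le_one h.le (absO_le_one x) hs.le

theorem absO_cpow_of_ord_eq {x : 𝒪[K]} {j : ℕ} (h : ord x = j) (s : ℂ) :
    (absO x : ℂ) ^ s = ((resCard K : ℂ) ^ (-s)) ^ j := by
  rw [absO_of_ord_eq h]
  have h1 : (((resCard K : ℝ)⁻¹ : ℝ) : ℂ) ^ s = (resCard K : ℂ) ^ (-s) := by
    rw [Complex.cpow_neg, Complex.ofReal_inv, Complex.ofReal_natCast, Complex.inv_cpow]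
    rw [Complex.natCast_arg]
    exact Real.pi_ne_zero.symm
  clear h
  induction j with
  | zero => simp
  | succ j ih =>
    rw [pow_succ, Complex.ofReal_mul, Complex.mul_cpow_ofReal_nonneg (by positivity)
      (by positivity), ih, h1, pow_succ]

variable [MeasurableSpace K] [BorelSpace K]

theorem measurable_absO : Measurable (absO : 𝒪[K] → ℝ) := by
  obtain ⟨π, hπ⟩ := IsDiscreteValuationRing.exists_irreducible 𝒪[K]
  have h1 : Measurable (ord : 𝒪[K] → ℕ∞) := by
    refine measurable_to_countable' fun k => ?_
    induction k using ENat.recTopCoe with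
    | top =>
      convert measurableSet_singleton (0 : 𝒪[K]) using 1
      ext x
      simp [ord, IsDiscreteValuationRing.addVal_eq_top_iff]
    | coe k =>
      have : ord ⁻¹' {(k : ℕ∞)} = {x : 𝒪[K] | π ^ k ∣ x} \ {x | π ^ (k + 1) ∣ x} := by
        ext x
        simp [ord_eq_coe_iff hπ]
      rw [this]
      exact (isClopen_pow_dvd hπ k).isClosed.measurableSet.diff
        (isClopen_pow_dvd hπ _).isClosed.measurableSet
  have h2 : (absO : 𝒪[K] → ℝ) =
      (fun k : ℕ∞ => if k = ⊤ then 0 else ((resCard K : ℝ) ^ k.toNat)⁻¹) ∘ ord := by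
    funext x
    by_cases hx : x = 0 <;> simp [absO, ord, hx, IsDiscreteValuationRing.addVal_eq_top_iff]
  rw [h2]
  exact (measurable_of_countable _).comp h1

theorem integrable_absO_cpow {Ω : Type*} [MeasurableSpace Ω] (ν : Measure Ω) [IsFiniteMeasure ν]
    {H : Ω → 𝒪[K]} (hH : Measurable H) {s : ℂ} (hs : 0 < s.re) :
    Integrable (fun x => (absO (H x) : ℂ) ^ s) ν :=
  Integrable.of_bound ((Complex.measurable_ofReal.comp
    (measurable_absO.comp hH)).pow_const s).aestronglyMeasurable 1
    (Filter.Eventually.of_forall fun _ => norm_absO_cpow_le_one _ hs)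

/-- The integrand equals `T^j` on the part of `S` where `H` has exact order `j`, and that part is
the difference of two consecutive divisibility sets. -/
theorem setIntegral_absO_cpow {π : 𝒪[K]} (hπ : Irreducible π) {Ω : Type*} [MeasurableSpace Ω]
    (ν : Measure Ω) [IsFiniteMeasure ν] {H : Ω → 𝒪[K]} (hH : Measurable H) {S : Set Ω}
    (hS : MeasurableSet S) {s : ℂ} (hs : 0 < s.re) :
    ∫ x in S, (absO (H x) : ℂ) ^ s ∂ν = ∑' j : ℕ, ((resCard K : ℂ) ^ (-s)) ^ j *
      ((ν.real (S ∩ {x | π ^ j ∣ H x}) - ν.real (S ∩ {x | π ^ (j + 1) ∣ H x}) : ℝ) : ℂ) := by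
  have hm : ∀ j, MeasurableSet (S ∩ {x | π ^ j ∣ H x}) := fun j =>
    hS.inter (measurableSet_pow_dvd hπ hH j)
  have hanti : ∀ j, S ∩ {x | π ^ (j + 1) ∣ H x} ⊆ S ∩ {x | π ^ j ∣ H x} := fun j x hx =>
    ⟨hx.1, (pow_dvd_pow π j.le_succ).trans hx.2⟩
  let E : ℕ → Set Ω := fun j => (S ∩ {x | π ^ j ∣ H x}) \ (S ∩ {x | π ^ (j + 1) ∣ H x})
  have hE : ∀ j, MeasurableSet (E j) := fun j => (hm j).diff (hm (j + 1))
  have hmem : ∀ j x, x ∈ E j → ord (H x) = j := fun j x hx =>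
    (ord_eq_coe_iff hπ).mpr ⟨hx.1.2, fun h => hx.2 ⟨hx.1.1, h⟩⟩
  have hsub : ⋃ j, E j ⊆ S := Set.iUnion_subset fun j x hx => hx.1.1
  rw [setIntegral_eq_of_subset_of_forall_sdiff_eq_zero hS hsub, integral_iUnion hE]
  · refine tsum_congr fun j => ?_
    rw [setIntegral_congr_fun (hE j) (g := fun _ => ((resCard K : ℂ) ^ (-s)) ^ j)
      fun x hx => absO_cpow_of_ord_eq (hmem j x hx) s, setIntegral_const, Complex.real_smul,
      mul_comm, measureReal_sdiff (hanti j) (hm _)]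
  · intro i j hij
    refine Set.disjoint_left.mpr fun x hx hx' => hij ?_
    exact_mod_cast (hmem i x hx).symm.trans (hmem j x hx')
  · exact (integrable_absO_cpow ν hH hs).integrableOn
  · rintro x ⟨hxS, hx⟩
    have h0 : H x = 0 := by
      by_contra h0
      obtain ⟨k, hk⟩ := ENat.ne_top_iff_exists.mp (show ord (H x) ≠ ⊤ by
        simpa [ord, IsDiscreteValuationRing.addVal_eq_top_iff] using h0)
      have h1 := (ord_eq_coe_iff hπ).mp hk.symm
      exact hx (Set.mem_iUnion.mpr ⟨k, ⟨hxS, h1.1⟩, fun h => h1.2 h.2⟩)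
    -- On the zero set the integrand is `0^s = 0`, so nothing need be known about the measure of
    -- that set.
    rw [h0, absO, if_pos rfl, Complex.ofReal_zero, Complex.zero_cpow (by rintro rfl; simp at hs)]

instance : (haarO K).IsAddHaarMeasure :=
  inferInstanceAs (Measure.addHaarMeasure ⊤).IsAddHaarMeasure

instance : IsProbabilityMeasure (haarO K) :=
  ⟨Measure.addHaarMeasure_self (K₀ := (⊤ : TopologicalSpace.PositiveCompacts 𝒪[K]))⟩

instance (σ : Type*) [Fintype σ] : IsProbabilityMeasure (haarPi K σ) :=
  inferInstanceAs (IsProbabilityMeasure (Measure.pi fun _ : σ => haarO K))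

end Local

/-! ### Decomposition into shells of given order -/

section Orders

theorem image_levelSet {R : Type*} [CommRing R] (π : R) {σ ρ : Type*} {F : MvPolynomial σ R} {G : MvPolynomial ρ R}
    {κ : σ → ℕ} {l : ρ → ℕ} {A B : ℕ}
    (hF : ∀ x : σ → R, MvPolynomial.eval (fun i => π ^ κ i * x i) F =
      π ^ A * MvPolynomial.eval x F)
    (hG : ∀ x : ρ → R, MvPolynomial.eval (fun i => π ^ l i * x i) G =
      π ^ B * MvPolynomial.eval x G) (j : ℕ) :
    scaleMap π (Sum.elim κ l) '' levelSet π F G j A B =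
      scaleMap π (Sum.elim κ l) '' {x | ∀ i, IsUnit (x i)} ∩
        {x | π ^ j ∣ MvPolynomial.eval x (directSum F G)} := by
  have h : ∀ x, MvPolynomial.eval (scaleMap π (Sum.elim κ l) x) (directSum F G) =
      π ^ A * MvPolynomial.eval (x ∘ Sum.inl) F + π ^ B * MvPolynomial.eval (x ∘ Sum.inr) G := by
    intro x
    rw [directSum, map_add, MvPolynomial.eval_rename, MvPolynomial.eval_rename, ← hF, ← hG]
    rfl
  ext x
  constructor
  · rintro ⟨y, ⟨hy, hj⟩, rfl⟩
    exact ⟨⟨y, hy, rfl⟩, by rwa [Set.mem_ofPred_eq, h]⟩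
  · rintro ⟨⟨y, hy, rfl⟩, hj⟩
    rw [Set.mem_ofPred_eq, h] at hj
    exact ⟨y, ⟨hy, hj⟩, rfl⟩


variable {K : Type*} [Field K] [ValuativeRel K] [TopologicalSpace K]
  [IsNonarchimedeanLocalField K] {π : 𝒪[K]} (hπ : Irreducible π)
include hπ

theorem mem_image_scaleMap_units_iff {σ : Type*} (κ : σ → ℕ) (x : σ → 𝒪[K]) :
    x ∈ scaleMap π κ '' {u | ∀ i, IsUnit (u i)} ↔ ∀ i, ord (x i) = κ i := by
  simp only [ord_eq_coe_iff hπ, pow_dvd_and_not_iff hπ]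
  constructor
  · rintro ⟨u, hu, rfl⟩ i
    exact ⟨u i, hu i, rfl⟩
  · intro h
    choose u hu hux using h
    exact ⟨u, hu, funext hux⟩

theorem orderSet_prodSet_latticeCone {n m u v : ℕ} (a : Fin u → Fin n → ℕ)
    (b : Fin v → Fin m → ℕ) :
    orderSet (K := K) (prodSet (latticeCone a) (latticeCone b)) =
      ⋃ k : (Fin u → ℕ) × (Fin v → ℕ),
        scaleMap π (Sum.elim (comb a k.1) (comb b k.2)) '' {x | ∀ i, IsUnit (x i)} := by
  ext x
  simp only [Set.mem_iUnion, mem_image_scaleMap_units_iff hπ]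
  have hinj : Function.Injective (toReal : (Fin n → ℕ) → _) := fun f g h => funext fun i => by
    simpa [toReal] using congrFun h i
  have hinj' : Function.Injective (toReal : (Fin m → ℕ) → _) := fun f g h => funext fun i => by
    simpa [toReal] using congrFun h i
  constructor
  · rintro ⟨κ, hκ, ⟨k, hk⟩, ⟨l, hl⟩⟩
    rw [← toReal_comb] at hk hl
    have hk' : κ ∘ Sum.inl = comb a k := hinj hk
    have hl' : κ ∘ Sum.inr = comb b l := hinj' hl
    refine ⟨(k, l), fun i => ?_⟩
    rw [hκ, ← hk', ← hl', Sum.elim_comp_inl_inr]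
  · rintro ⟨k, hk⟩
    exact ⟨_, hk, ⟨k.1, by rw [← toReal_comb]; rfl⟩, ⟨k.2, by rw [← toReal_comb]; rfl⟩⟩

theorem pairwise_disjoint_scaleMap_units {n m u v : ℕ} {a : Fin u → Fin n → ℕ}
    {b : Fin v → Fin m → ℕ} (ha : LinearIndependent ℝ fun i => toReal (a i))
    (hb : LinearIndependent ℝ fun j => toReal (b j)) :
    Pairwise (Function.onFun Disjoint fun k : (Fin u → ℕ) × (Fin v → ℕ) =>
      scaleMap π (Sum.elim (comb a k.1) (comb b k.2)) '' {x | ∀ i, IsUnit (x i)}) := by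
  intro k l hkl
  refine Set.disjoint_left.mpr fun x hx hx' => hkl ?_
  rw [mem_image_scaleMap_units_iff hπ] at hx hx'
  have h : ∀ i, Sum.elim (comb a k.1) (comb b k.2) i = Sum.elim (comb a l.1) (comb b l.2) i :=
    fun i => by exact_mod_cast (hx i).symm.trans (hx' i)
  exact Prod.ext (comb_injective ha (funext fun i => h (Sum.inl i)))
    (comb_injective hb (funext fun i => h (Sum.inr i)))

end Orders

theorem qpow_cFun {σ ρ : Type*} [Fintype σ] [Fintype ρ] {R : Type*} [CommRing R] {q : ℕ}
    (hq : 1 < q) (f : MvPolynomial σ R) (g : MvPolynomial ρ R) (a : σ → ℕ) (b : ρ → ℕ) (s : ℂ) :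
    qpow q (cFun f g a b s) = rayFactor q (∑ i, a i) (minDotNat f a) (∑ j, b j) (minDotNat g b)
      ((q : ℂ) ^ (-s)) := by
  have hq0 : (q : ℂ) ≠ 0 := by exact_mod_cast (by omega : q ≠ 0)
  unfold rayFactor cFun
  simp only []
  split_ifs with h
  · change (q : ℂ) ^ (_ : ℂ) = _
    rw [sub_sub, sub_eq_add_neg, Complex.cpow_add _ _ hq0, mul_comm]
    congr 1
    · rw [Complex.cpow_neg, inv_pow, ← Complex.cpow_natCast]
      congr 2
      push_cast
      ring
    · rw [← Complex.cpow_nat_mul]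
      congr 1
      ring
  · rfl

theorem norm_rayFactor_lt_one {q : ℕ} (hq : 1 < q) (p α r β : ℕ) {T : ℂ} (hT : ‖T‖ < 1) :
    ‖rayFactor q p α r β T‖ < 1 := by
  unfold rayFactor
  split_ifs with h
  · rw [norm_mul, norm_pow, norm_pow, norm_inv, Complex.norm_natCast]
    have h1 : (q : ℝ)⁻¹ ≤ 1 := inv_le_one_of_one_le₀ (by exact_mod_cast hq.le)
    exact mul_lt_one_of_nonneg_of_lt_one_right (pow_le_one₀ (by positivity) h1) (by positivity)
      (pow_lt_one₀ (norm_nonneg _) hT (Nat.lcm_ne_zero h.1.ne' h.2.ne'))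
  · simp

/-! ### Assembly of the zeta integral -/

section Zeta

variable {K : Type*} [Field K] [ValuativeRel K] [TopologicalSpace K]
  [IsNonarchimedeanLocalField K] [MeasurableSpace K] [BorelSpace K]

theorem integrable_zetaIntegrand {σ : Type*} [Fintype σ] (h : MvPolynomial σ 𝒪[K]) {s : ℂ}
    (hs : 0 < s.re) : Integrable (zetaIntegrand h s) (haarPi K σ) :=
  integrable_absO_cpow _ (MvPolynomial.continuous_eval h).measurable hs

/-- The masses of the level sets define a polynomial weight that computes the integrals over
the points with given orders. -/
theorem exists_isWeight_setIntegral {π : 𝒪[K]} (hπ : Irreducible π) {σ ρ : Type*} [Fintype σ]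
    [Fintype ρ] (F : MvPolynomial σ 𝒪[K]) (G : MvPolynomial ρ 𝒪[K])
    (hF : ∀ u : σ → 𝒪[K], (∀ i, IsUnit (u i)) →
      ∃ i, MvPolynomial.eval u (MvPolynomial.pderiv i F) ≠ 0)
    (hG : ∀ u : ρ → 𝒪[K], (∀ i, IsUnit (u i)) →
      ∃ i, MvPolynomial.eval u (MvPolynomial.pderiv i G) ≠ 0) :
    ∃ w : ℕ → ℕ → ℚ[X], IsWeight w ∧ ∀ (κ : σ → ℕ) (l : ρ → ℕ) (A B : ℕ),
      (∀ x : σ → 𝒪[K], MvPolynomial.eval (fun i => π ^ κ i * x i) F =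
        π ^ A * MvPolynomial.eval x F) →
      (∀ x : ρ → 𝒪[K], MvPolynomial.eval (fun i => π ^ l i * x i) G =
        π ^ B * MvPolynomial.eval x G) →
      ∀ s : ℂ, 0 < s.re → ‖(resCard K : ℂ) ^ (-s)‖ < 1 →
      (1 - (resCard K : ℂ)⁻¹ * (resCard K : ℂ) ^ (-s)) *
        ∫ x in scaleMap π (Sum.elim κ l) '' {x | ∀ i, IsUnit (x i)},
          zetaIntegrand (directSum F G) s x ∂(haarPi K (σ ⊕ ρ)) =
        ((resCard K : ℂ)⁻¹) ^ (∑ i, κ i + ∑ j, l j) *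
          Polynomial.aeval ((resCard K : ℂ) ^ (-s)) (w A B) := by
  choose V hV using exists_rat_levelSet hπ (haarO K) F G
  have hcard := resCard_eq hπ
  obtain ⟨w, hw, hwV⟩ := exists_isWeight_of_levels (one_lt_resCard (K := K)) V
    (fun A B A' B' => by
      have : levelSet π F G 0 A B = levelSet π F G 0 A' B' := by simp [levelSet]
      exact_mod_cast (hV 0 A B).symm.trans (this ▸ hV 0 A' B'))
    (fun j A B => by
      have := hV (j + 1) (A + 1) (B + 1)
      rw [levelSet_succ hπ, hV j A B] at this
      exact_mod_cast this.symm)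
    (fun A B => by
      obtain ⟨N, hN⟩ := exists_levelSet_geometric hπ (haarO K) F G hF A B
      refine ⟨N, fun j hj => ?_⟩
      have := hN j hj
      rw [hV, hV, ← hcard] at this
      exact_mod_cast this)
    (by
      obtain ⟨N, hN⟩ := exists_levelSet_right hπ (haarO K) F G hF
      refine ⟨N, fun d hd j => ?_⟩
      have := hN d hd j
      rw [hV, hV] at this
      exact_mod_cast this)
    (by
      obtain ⟨N, hN⟩ := exists_levelSet_left hπ (haarO K) F G hG
      refine ⟨N, fun d hd j => ?_⟩
      have := hN d hd j
      rw [hV, hV] at this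
      exact_mod_cast this)
  refine ⟨w, hw, fun κ l A B hκ hl s hs hT => ?_⟩
  have hS : MeasurableSet (scaleMap π (Sum.elim κ l) '' {x : σ ⊕ ρ → 𝒪[K] | ∀ i, IsUnit (x i)}) :=
    (isClosedEmbedding_scaleMap hπ _).measurableEmbedding.measurableSet_image.mpr
      (isClopen_units hπ _).isClosed.measurableSet
  have h1 := setIntegral_absO_cpow hπ (haarPi K (σ ⊕ ρ))
    (MvPolynomial.continuous_eval (directSum F G)).measurable hS hs
  simp only [← image_levelSet π hκ hl] at h1
  have h2 : ∀ j, (haarPi K (σ ⊕ ρ)).real (scaleMap π (Sum.elim κ l) '' levelSet π F G j A B) =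
      ((resCard K : ℝ)⁻¹) ^ (∑ i, κ i + ∑ j, l j) * V j A B := fun j => by
    rw [← hV, hcard]
    refine (measureReal_image_scaleMap hπ (haarO K) _ _).trans ?_
    rw [Fintype.sum_sum_type]
    rfl
  simp only [zetaIntegrand]
  rw [h1, ← hwV A B _ hT, mul_left_comm (_ ^ _), ← tsum_mul_left (a := _ ^ (_ + _))]
  congr 2
  funext j
  rw [h2, h2]
  push_cast
  ring

/-- The integral is countably additive over the disjoint shells; the shell integrals form the
generating series of a weight, and the ray factors are the numbers `q^c`. -/
theorem exists_ratPoly_zeta {n m : ℕ} (f : MvPolynomial (Fin n) 𝒪[K])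
    (g : MvPolynomial (Fin m) 𝒪[K])
    (hfN : NewtonNonCritical f) (hgN : NewtonNonCritical g)
    (τ : Set (Fin n → ℝ)) (hτ : IsFace (newtonPolyhedron f) τ)
    (γ : Set (Fin m → ℝ)) (hγ : IsFace (newtonPolyhedron g) γ)
    {u v : ℕ} (a : Fin u → Fin n → ℕ) (b : Fin v → Fin m → ℕ)
    (ha : LinearIndependent ℝ fun i => toReal (a i))
    (hb : LinearIndependent ℝ fun j => toReal (b j))
    (haτ : latticeCone a ⊆ closure (faceCone f τ))
    (hbγ : latticeCone b ⊆ closure (faceCone g γ)) :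
    ∃ P : ℚ[X], ∀ s : ℂ, 0 < s.re → ‖(resCard K : ℂ) ^ (-s)‖ < 1 →
      (∏ i, ∏ j, (1 - qpow (resCard K) (cFun f g (a i) (b j) s))) *
        ((1 - (resCard K : ℂ)⁻¹ * (resCard K : ℂ) ^ (-s)) *
          zeta (prodSet (latticeCone a) (latticeCone b))
            (directSum (facePoly f τ) (facePoly g γ)) s) =
        Polynomial.aeval ((resCard K : ℂ) ^ (-s)) P := by
  obtain ⟨π, hπ⟩ := IsDiscreteValuationRing.exists_irreducible 𝒪[K]
  obtain ⟨w, hw, hwI⟩ := exists_isWeight_setIntegral hπ (facePoly f τ) (facePoly g γ)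
    (hfN.exists_eval_pderiv_ne_zero hτ) (hgN.exists_eval_pderiv_ne_zero hγ)
  obtain ⟨P, hP⟩ := monoidSum_isRatPoly (one_lt_resCard (K := K)) (fun i => ∑ j, a i j)
    (fun i => minDotNat f (a i)) (fun i => ∑ j, b i j) (fun i => minDotNat g (b i))
    (sum_pos_of_linearIndependent ha) (sum_pos_of_linearIndependent hb) hw
  refine ⟨P, fun s hs hT => ?_⟩
  rw [← hP _ hT]
  simp only [qpow_cFun (one_lt_resCard (K := K))]
  congr 1
  rw [zeta, orderSet_prodSet_latticeCone hπ, integral_iUnion (fun k =>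
      (isClosedEmbedding_scaleMap hπ _).measurableEmbedding.measurableSet_image.mpr
        (isClopen_units hπ _).isClosed.measurableSet)
    (pairwise_disjoint_scaleMap_units hπ ha hb)
    (integrable_zetaIntegrand _ hs).integrableOn,
    ← tsum_mul_left, monoidSum]
  refine tsum_congr fun k => ?_
  rw [hwI _ _ _ _ (eval_scale_comb_facePoly haτ π k.1)
    (eval_scale_comb_facePoly hbγ π k.2) s hs hT, sum_comb, sum_comb]

end Zeta

end NewtonIgusa

theorem mainTheorem4 {K : Type*} [Field K] [ValuativeRel K] [TopologicalSpace K]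
    [IsNonarchimedeanLocalField K] [CharZero K] [MeasurableSpace K] [BorelSpace K]
    {n m : ℕ} (f : MvPolynomial (Fin n) 𝒪[K]) (g : MvPolynomial (Fin m) 𝒪[K])
    (hf : f ≠ 0) (hf0 : MvPolynomial.constantCoeff f = 0)
    (hg : g ≠ 0) (hg0 : MvPolynomial.constantCoeff g = 0)
    (hfN : NewtonNonCritical f) (hgN : NewtonNonCritical g)
    (τ : Set (Fin n → ℝ)) (hτ : IsFace (newtonPolyhedron f) τ)
    (γ : Set (Fin m → ℝ)) (hγ : IsFace (newtonPolyhedron g) γ)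
    {u v : ℕ} (a : Fin u → Fin n → ℕ) (b : Fin v → Fin m → ℕ)
    (ha : LinearIndependent ℝ fun i => toReal (a i))
    (hb : LinearIndependent ℝ fun j => toReal (b j))
    (haτ : latticeCone a ⊆ closure (faceCone f τ))
    (hbγ : latticeCone b ⊆ closure (faceCone g γ)) :
    ∃ P : ℚ[X], ∀ s : ℂ, 0 < s.re →
      IntegrableOn (zetaIntegrand (directSum (facePoly f τ) (facePoly g γ)) s)
        (orderSet (prodSet (latticeCone a) (latticeCone b))) (haarPi K (Fin n ⊕ Fin m)) ∧
      zeta (prodSet (latticeCone a) (latticeCone b))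
          (directSum (facePoly f τ) (facePoly g γ)) s =
        Polynomial.aeval ((resCard K : ℂ) ^ (-s)) P /
          ((1 - (resCard K : ℂ) ^ (-1 - s)) *
            ∏ i, ∏ j, (1 - qpow (resCard K) (cFun f g (a i) (b j) s))) := by

  have hq := one_lt_resCard (K := K)
  have hq0 : (resCard K : ℂ) ≠ 0 := by exact_mod_cast (by omega : resCard K ≠ 0)
  obtain ⟨P, hP⟩ := exists_ratPoly_zeta f g hfN hgN τ hτ γ hγ a b ha hb haτ hbγ
  refine ⟨P, fun s hs => ⟨(integrable_zetaIntegrand _ hs).integrableOn, ?_⟩⟩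
  have hT : ‖(resCard K : ℂ) ^ (-s)‖ < 1 := by
    rw [Complex.norm_natCast_cpow_of_pos (by omega)]
    exact Real.rpow_lt_one_of_one_lt_of_neg (by exact_mod_cast hq) (by simpa using hs)
  have h1 : (resCard K : ℂ) ^ (-1 - s) = (resCard K : ℂ)⁻¹ * (resCard K : ℂ) ^ (-s) := by
    rw [sub_eq_add_neg, Complex.cpow_add _ _ hq0, Complex.cpow_neg_one]
  -- Every factor of the denominator has the form `1 - t` with `‖t‖ < 1`, since `‖T‖ < 1` for
  -- positive real part; this permits the division.
  have h2 : ∀ t : ℂ, ‖t‖ < 1 → 1 - t ≠ 0 := fun t ht h => by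
    rw [← sub_eq_zero.mp h] at ht
    simp at ht
  have h3 : 1 - (resCard K : ℂ)⁻¹ * (resCard K : ℂ) ^ (-s) ≠ 0 := by
    refine h2 _ ?_
    rw [norm_mul, norm_inv, Complex.norm_natCast]
    exact mul_lt_one_of_nonneg_of_lt_one_left (by positivity)
      (inv_lt_one_of_one_lt₀ (by exact_mod_cast hq)) hT.le
  have h4 : ∏ i, ∏ j, (1 - qpow (resCard K) (cFun f g (a i) (b j) s)) ≠ 0 :=
    Finset.prod_ne_zero_iff.mpr fun i _ => Finset.prod_ne_zero_iff.mpr fun j _ => by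
      rw [qpow_cFun hq]
      exact h2 _ (norm_rayFactor_lt_one hq _ _ _ _ hT)
  rw [h1, eq_div_iff (mul_ne_zero h3 h4), ← hP s hs hT]
  ring
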